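/- Let $n\ge 4$ and $m>0$, put $R_0=(m/2)^{1/(n-2)}$, and let $M=\{x\in\mathbb{R}^n : |x|\ge R_0\}$ carry the Riemannian Schwarzschild metric $$g_{Sch}=\Big(1+\frac{m}{2|x|^{n-2}}\Big)^{\frac{4}{n-2}}\delta ,$$ where $\delta$ is the Euclidean metric. Let $\Sigma=\rho(\Sigma_0)$, where $\Sigma_0=\{x\in\mathbb{R}^n : x_n=0,\ |x|\ge R_0\}$ and $\rho$ is any linear isometry of $\mathbb{R}^n$. Let $\xi$ be a unit normal field of $\Sigma$, $\nu$ the outward unit conormal of $\partial\Sigma=\Sigma\cap\{|x|=R_0\}$ in $\Sigma$, $\mathrm{Ric}$ the Ricci curvature of $g_{Sch}$, and $A_\Sigma$, $A_{\partial M}$ the second fundamental forms of $\Sigma$ and of the horizon $\partial M=\{|x|=R_0\}$ (the latter with respect to the unit normal $\eta$ pointing into $M$, $A_{\partial M}(V,W)=-g_{Sch}(\nabla_V\eta,W)$); all geometric quantities, including the Laplacian $\Delta_\Sigma$ and the measures $dv$ on $\Sigma$ and $ds$ on $\partial\Sigma$, refer to $g_{Sch}$ and to the metric it induces. For $R>R_0$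 let $\Sigma(R)=\Sigma\cap\{|x|\le R\}$, and for smooth $u:\Sigma(R)\to\mathbb{R}$ (up to the boundary) vanishing on $\{|x|=R\}$ put $$Q(u,u)=-\int_{\Sigma(R)}u\big(\Delta_\Sigma u+(\mathrm{Ric}(\xi,\xi)+|A_\Sigma|^2)u\big)\,dv+\int_{\partial\Sigma}u\Big(\frac{\partial u}{\partial\nu}-A_{\partial M}(\xi,\xi)u\Big)\,ds .$$ Let $\mathrm{Ind}_F(\Sigma(R))$ be the maximal dimension of a linear space $V$ of such functions with $Q(u,u)<0$ for all $u\in V\setminus\{0\}$, and define the Morse index of $\Sigma$ by $\mathrm{Ind}(\Sigma)=\limsup_{R\to\infty}\mathrm{Ind}_F(\Sigma(R))\in\{0,1,2,\dots,\infty\}$. Then $\mathrm{Ind}(\Sigma)=0$; that is, $\Sigma$ is stable. In particular $\mathrm{Ind}(\Sigma_0)=0$. -/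

import Mathlib

open MeasureTheory Filter
open scoped ContDiff

noncomputable section

namespace Schwarzschild

/-- Euclidean space `ℝⁿ`. -/
abbrev E (n : ℕ) : Type := EuclideanSpace ℝ (Fin n)

/-! ### Riemannian geometry in coordinates

A metric on a region of `ℝⁿ` is given by its matrix of components `G x i j = g_{ij}(x)`. -/

/-- The `i`-th coordinate vector. -/
def basisVec {n : ℕ} (i : Fin n) : E n := EuclideanSpace.single i 1

/-- `g_x(v, w)`. -/
def metricForm {n : ℕ} (G : E n → Matrix (Fin n) (Fin n) ℝ) (x v w : E n) : ℝ :=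
  ∑ i, ∑ j, G x i j * v i * w j

/-- The partial derivative `∂_i f` of a function defined near `x`. -/
def pderiv {n : ℕ} (i : Fin n) (f : E n → ℝ) (x : E n) : ℝ :=
  fderiv ℝ f x (basisVec i)

/-- The Christoffel symbol `Γ^k_{ij}` of the Levi-Civita connection. -/
def christoffel {n : ℕ} (G : E n → Matrix (Fin n) (Fin n) ℝ) (k i j : Fin n) (x : E n) : ℝ :=
  (1 / 2) * ∑ l, (G x)⁻¹ k l *
    (pderiv i (fun z => G z j l) x + pderiv j (fun z => G z i l) x
      - pderiv l (fun z => G z i j) x)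

/-- The components `R_{ij}` of the Ricci tensor (positive on round spheres). -/
def ricciComp {n : ℕ} (G : E n → Matrix (Fin n) (Fin n) ℝ) (i j : Fin n) (x : E n) : ℝ :=
  ∑ k, (pderiv k (christoffel G k i j) x - pderiv j (christoffel G k i k) x
    + ∑ l, (christoffel G k k l x * christoffel G l i j x
      - christoffel G k j l x * christoffel G l i k x))

/-- `Ric_x(v, w)`. -/
def ricci {n : ℕ} (G : E n → Matrix (Fin n) (Fin n) ℝ) (x v w : E n) : ℝ :=
  ∑ i, ∑ j, ricciComp G i j x * v i * w j

/-- The Levi-Civita derivative `∇_v Y` at `x`. -/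
def covDeriv {n : ℕ} (G : E n → Matrix (Fin n) (Fin n) ℝ) (Y : E n → E n) (x v : E n) : E n :=
  WithLp.toLp 2 fun k =>
    fderiv ℝ Y x v k + ∑ i, ∑ j, christoffel G k i j x * v i * Y x j

/-- The second fundamental form `A(v, w) = -g(∇_v ζ, w)` with respect to the unit normal
field `ζ`, for tangent vectors `v`, `w`. -/
def secondFundamentalForm {n : ℕ} (G : E n → Matrix (Fin n) (Fin n) ℝ) (ζ : E n → E n)
    (x v w : E n) : ℝ :=
  -metricForm G x (covDeriv G ζ x v) w

/-! ### Hypersurfaces in a chart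

A hypersurface of `ℝ^{d+1}` is described by a chart `φ` on a region of `ℝ^d`. -/

/-- The coordinate tangent vector `∂_i φ`. -/
def coordTangent {d n : ℕ} (φ : E d → E n) (i : Fin d) (y : E d) : E n :=
  fderiv ℝ φ y (basisVec i)

/-- The induced metric `h_{ij} = g(∂_i φ, ∂_j φ)`. -/
def inducedMetric {d n : ℕ} (G : E n → Matrix (Fin n) (Fin n) ℝ) (φ : E d → E n) (y : E d) :
    Matrix (Fin d) (Fin d) ℝ :=
  Matrix.of fun i j => metricForm G (φ y) (coordTangent φ i y) (coordTangent φ j y)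

/-- The squared norm `|A|² = h^{ik} h^{jl} A_{ij} A_{kl}` of the second fundamental form. -/
def normSqSecondFundamentalForm {d n : ℕ} (G : E n → Matrix (Fin n) (Fin n) ℝ)
    (φ : E d → E n) (ζ : E n → E n) (y : E d) : ℝ :=
  ∑ i, ∑ j, ∑ k, ∑ l,
    (inducedMetric G φ y)⁻¹ i k * (inducedMetric G φ y)⁻¹ j l *
      secondFundamentalForm G ζ (φ y) (coordTangent φ i y) (coordTangent φ j y) *
      secondFundamentalForm G ζ (φ y) (coordTangent φ k y) (coordTangent φ l y)

/-- The partial derivative `∂_i w` of a function `w` that is only given on `S`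
(one-sided at the boundary of `S`). -/
def pderivOn {d : ℕ} (S : Set (E d)) (i : Fin d) (w : E d → ℝ) (y : E d) : ℝ :=
  fderivWithin ℝ w S y (basisVec i)

/-- The density `√(det h)` of the Riemannian volume. -/
def volDensity {d : ℕ} (h : E d → Matrix (Fin d) (Fin d) ℝ) (y : E d) : ℝ :=
  Real.sqrt (h y).det

/-- The Laplace–Beltrami operator
`Δ_h w = (det h)^{-1/2} ∂_i ((det h)^{1/2} h^{ij} ∂_j w)` on `S`. -/
def laplaceBeltrami {d : ℕ} (h : E d → Matrix (Fin d) (Fin d) ℝ) (S : Set (E d))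
    (w : E d → ℝ) (y : E d) : ℝ :=
  (volDensity h y)⁻¹ *
    ∑ i, pderivOn S i (fun z => volDensity h z * ∑ j, (h z)⁻¹ i j * pderivOn S j w z) y

/-! ### The Schwarzschild space -/

/-- The horizon radius `R₀ = (m/2)^{1/(n-2)}`. -/
def horizonRadius (n : ℕ) (m : ℝ) : ℝ := (m / 2) ^ (1 / ((n : ℝ) - 2))

/-- The conformal factor `(1 + m / (2|x|^{n-2}))^{4/(n-2)}`. -/
def conformalFactor (n : ℕ) (m : ℝ) (x : E n) : ℝ :=
  (1 + m / (2 * ‖x‖ ^ (n - 2))) ^ (4 / ((n : ℝ) - 2))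

/-- The Riemannian Schwarzschild metric of mass `m`; the Schwarzschild space is the region
`|x| ≥ R₀` with this metric. -/
def schwarzschildMetric (n : ℕ) (m : ℝ) (x : E n) : Matrix (Fin n) (Fin n) ℝ :=
  conformalFactor n m x • (1 : Matrix (Fin n) (Fin n) ℝ)

/-- The unit normal `η` along the horizon `|x| = R₀` pointing into `|x| ≥ R₀`
(extended radially). -/
def horizonNormal (n : ℕ) (m : ℝ) (x : E n) : E n :=
  (Real.sqrt (conformalFactor n m x) * ‖x‖)⁻¹ • x

/-- The hypersurface `Σ₀ = {x_n = 0, |x| ≥ R₀}`, where `n = d + 1`. -/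
def Sigma0 (d : ℕ) (m : ℝ) : Set (E (d + 1)) :=
  {x | x (Fin.last d) = 0 ∧ horizonRadius (d + 1) m ≤ ‖x‖}

/-- `Σ(R) = Σ ∩ {|x| ≤ R}` for the rotated hypersurface `Σ = ρ(Σ₀)`. -/
def SigmaR (d : ℕ) (m : ℝ) (ρ : E (d + 1) ≃ₗᵢ[ℝ] E (d + 1)) (R : ℝ) : Set (E (d + 1)) :=
  (ρ '' Sigma0 d m) ∩ {x | ‖x‖ ≤ R}

/-- The unit normal field `ξ` of `ρ(Σ₀)`. -/
def normalField (d : ℕ) (m : ℝ) (ρ : E (d + 1) ≃ₗᵢ[ℝ] E (d + 1)) (x : E (d + 1)) : E (d + 1) :=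
  (Real.sqrt (conformalFactor (d + 1) m x))⁻¹ • ρ (basisVec (Fin.last d))

/-- The global chart `y ↦ ρ(y, 0)` of `ρ(Σ₀)`. -/
def chart (d : ℕ) (ρ : E (d + 1) ≃ₗᵢ[ℝ] E (d + 1)) (y : E d) : E (d + 1) :=
  ρ (WithLp.toLp 2 (Fin.snoc (α := fun _ => ℝ) (fun i => y i) 0))

/-- The closed annulus that corresponds to `Σ(R)` in the chart. -/
def annulus (d : ℕ) (m : ℝ) (R : ℝ) : Set (E d) :=
  {y | horizonRadius (d + 1) m ≤ ‖y‖ ∧ ‖y‖ ≤ R}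

theorem norm_snoc_zero (d : ℕ) (y : E d) :
    ‖(WithLp.toLp 2 (Fin.snoc (α := fun _ => ℝ) (fun i => y i) 0) : E (d + 1))‖ = ‖y‖ := by
  simp [EuclideanSpace.norm_eq, Fin.sum_univ_castSucc]

theorem norm_chart (d : ℕ) (ρ : E (d + 1) ≃ₗᵢ[ℝ] E (d + 1)) (y : E d) :
    ‖chart d ρ y‖ = ‖y‖ := by
  rw [chart, LinearIsometryEquiv.norm_map, norm_snoc_zero]

/-- The chart maps the annulus bijectively onto `Σ(R)`. -/
theorem chart_bijOn (d : ℕ) (m : ℝ) (ρ : E (d + 1) ≃ₗᵢ[ℝ] E (d + 1)) (R : ℝ) :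
    Set.BijOn (chart d ρ) (annulus d m R) (SigmaR d m ρ R) := by
  refine ⟨?_, ?_, ?_⟩
  · rintro y ⟨h1, h2⟩
    refine ⟨⟨_, ⟨?_, ?_⟩, rfl⟩, ?_⟩
    · simp
    · rw [norm_snoc_zero]; exact h1
    · simpa [norm_chart] using h2
  · intro y _ z _ h
    have h' := ρ.injective h
    ext i
    have := congrArg (fun v : E (d + 1) => v i.castSucc) h'
    simpa using this
  · rintro _ ⟨⟨x, ⟨hx0, hx1⟩, rfl⟩, hR⟩
    have hx : (WithLp.toLp 2 (Fin.snoc (α := fun _ => ℝ)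
        (fun i => (WithLp.toLp 2 (fun i : Fin d => x i.castSucc) : E d) i) 0) : E (d + 1)) = x := by
      ext i
      refine Fin.lastCases ?_ (fun i => ?_) i
      · simpa using hx0.symm
      · simp
    refine ⟨WithLp.toLp 2 (fun i => x i.castSucc), ⟨?_, ?_⟩, ?_⟩
    · rw [← norm_snoc_zero, hx]; exact hx1
    · rw [← norm_snoc_zero, hx]; simpa using hR
    · rw [chart, hx]

/-! ### The index form and the Morse index -/

open Classical in
/-- A function on `Σ(R)` written in the chart (the value off the annulus plays no role). -/
def inChart {d : ℕ} {m : ℝ} {ρ : E (d + 1) ≃ₗᵢ[ℝ] E (d + 1)} {R : ℝ}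
    (u : SigmaR d m ρ R → ℝ) (y : E d) : ℝ :=
  if h : chart d ρ y ∈ SigmaR d m ρ R then u ⟨chart d ρ y, h⟩ else 0

/-- The metric induced on `ρ(Σ₀)` by the Schwarzschild metric, in the chart. -/
def sigmaMetric (d : ℕ) (m : ℝ) (ρ : E (d + 1) ≃ₗᵢ[ℝ] E (d + 1)) :
    E d → Matrix (Fin d) (Fin d) ℝ :=
  inducedMetric (schwarzschildMetric (d + 1) m) (chart d ρ)

/-- The Jacobi operator `J u = Δ_Σ u + (Ric(ξ, ξ) + |A_Σ|²) u` on `Σ(R)`, in the chart. -/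
def jacobiOperator (d : ℕ) (m : ℝ) (ρ : E (d + 1) ≃ₗᵢ[ℝ] E (d + 1)) (R : ℝ)
    (w : E d → ℝ) (y : E d) : ℝ :=
  laplaceBeltrami (sigmaMetric d m ρ) (annulus d m R) w y +
    (ricci (schwarzschildMetric (d + 1) m) (chart d ρ y)
        (normalField d m ρ (chart d ρ y)) (normalField d m ρ (chart d ρ y)) +
      normSqSecondFundamentalForm (schwarzschildMetric (d + 1) m) (chart d ρ)
        (normalField d m ρ) y) * w y

/-- The Euclidean unit conormal (as a covector) of the sphere `∂Σ` in the chart, pointing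
out of `Σ`, that is, towards the origin. -/
def conormalCovector (d : ℕ) (y : E d) (i : Fin d) : ℝ := -(y i / ‖y‖)

/-- The length `(h^{ij} n_i n_j)^{1/2}` of the covector `n` above in the metric of `Σ`. -/
def conormalLength (d : ℕ) (m : ℝ) (ρ : E (d + 1) ≃ₗᵢ[ℝ] E (d + 1)) (y : E d) : ℝ :=
  Real.sqrt (∑ i, ∑ j, (sigmaMetric d m ρ y)⁻¹ i j * conormalCovector d y i *
    conormalCovector d y j)

/-- The derivative `∂w/∂ν` along the outward unit conormal
`ν^i = h^{ij} n_j / (h^{kl} n_k n_l)^{1/2}` of `∂Σ`. -/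
def conormalDeriv (d : ℕ) (m : ℝ) (ρ : E (d + 1) ≃ₗᵢ[ℝ] E (d + 1)) (R : ℝ)
    (w : E d → ℝ) (y : E d) : ℝ :=
  (conormalLength d m ρ y)⁻¹ *
    ∑ i, ∑ j, (sigmaMetric d m ρ y)⁻¹ i j * conormalCovector d y j *
      pderivOn (annulus d m R) i w y

/-- The integral over `∂Σ` of a function `F` given in the chart, against the Riemannian measure
`ds = (det h)^{1/2} (h^{ij} n_i n_j)^{1/2} dσ`, where `dσ` is the Euclidean surface measure of
the sphere of radius `R₀` in `ℝ^d`. -/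
def boundaryIntegral (d : ℕ) (m : ℝ) (ρ : E (d + 1) ≃ₗᵢ[ℝ] E (d + 1)) (F : E d → ℝ) : ℝ :=
  ∫ θ : Metric.sphere (0 : E d) 1,
    (fun y : E d => F y * (volDensity (sigmaMetric d m ρ) y * conormalLength d m ρ y))
        (horizonRadius (d + 1) m • (θ : E d)) * horizonRadius (d + 1) m ^ (d - 1)
      ∂(volume : Measure (E d)).toSphere

/-- The index form
`Q(u, u) = -∫_{Σ(R)} u J u dv + ∫_{∂Σ} u (∂u/∂ν - A_{∂M}(ξ, ξ) u) ds`. -/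
def indexForm (d : ℕ) (m : ℝ) (ρ : E (d + 1) ≃ₗᵢ[ℝ] E (d + 1)) (R : ℝ)
    (u : SigmaR d m ρ R → ℝ) : ℝ :=
  -(∫ y in annulus d m R,
      inChart u y * jacobiOperator d m ρ R (inChart u) y * volDensity (sigmaMetric d m ρ) y) +
    boundaryIntegral d m ρ (fun y =>
      inChart u y * (conormalDeriv d m ρ R (inChart u) y -
        secondFundamentalForm (schwarzschildMetric (d + 1) m) (horizonNormal (d + 1) m)
          (chart d ρ y) (normalField d m ρ (chart d ρ y)) (normalField d m ρ (chart d ρ y)) *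
        inChart u y))

/-- Functions on `Σ(R)` that are smooth up to the boundary and vanish on `|x| = R`. -/
def Admissible (d : ℕ) (m : ℝ) (ρ : E (d + 1) ≃ₗᵢ[ℝ] E (d + 1)) (R : ℝ)
    (u : SigmaR d m ρ R → ℝ) : Prop :=
  ContDiffOn ℝ ∞ (inChart u) (annulus d m R) ∧
    ∀ x : SigmaR d m ρ R, ‖(x : E (d + 1))‖ = R → u x = 0

/-- The Morse index of `Σ(R)` for functions vanishing on `|x| = R`: the maximal dimension of a
linear space of admissible functions on which the index form is negative definite. -/
def morseIndexR (d : ℕ) (m : ℝ) (ρ : E (d + 1) ≃ₗᵢ[ℝ] E (d + 1)) (R : ℝ) : ℕ∞ :=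
  ⨆ V ∈ {V : Submodule ℝ (SigmaR d m ρ R → ℝ) |
      (∀ u ∈ V, Admissible d m ρ R u) ∧ ∀ u ∈ V, u ≠ 0 → indexForm d m ρ R u < 0},
    Cardinal.toENat (Module.rank ℝ V)

/-- The Morse index of `ρ(Σ₀)` in the Schwarzschild space. -/
def morseIndex (d : ℕ) (m : ℝ) (ρ : E (d + 1) ≃ₗᵢ[ℝ] E (d + 1)) : ℕ∞ :=
  limsup (fun R : ℝ => morseIndexR d m ρ R) atTop

/-! ### Basic facts about the unit normals -/

theorem conformalFactor_pos (n : ℕ) (m : ℝ) (hm : 0 < m) (x : E n) :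
    0 < conformalFactor n m x := by
  unfold conformalFactor
  positivity

theorem metricForm_schwarzschild (n : ℕ) (m : ℝ) (x v w : E n) :
    metricForm (schwarzschildMetric n m) x v w = conformalFactor n m x * inner ℝ v w := by
  simp [metricForm, schwarzschildMetric, Matrix.one_apply, PiLp.inner_apply, Finset.mul_sum]
  exact Finset.sum_congr rfl fun i _ => by ring

/-- `ξ` has unit length. -/
theorem normalField_unit (d : ℕ) (m : ℝ) (hm : 0 < m) (ρ : E (d + 1) ≃ₗᵢ[ℝ] E (d + 1))
    (x : E (d + 1)) :
    metricForm (schwarzschildMetric (d + 1) m) x (normalField d m ρ x) (normalField d m ρ x)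
      = 1 := by
  have h := conformalFactor_pos (d + 1) m hm x
  rw [metricForm_schwarzschild, real_inner_self_eq_norm_sq, normalField, norm_smul,
    LinearIsometryEquiv.norm_map, mul_pow]
  simp [basisVec, Real.sq_sqrt h.le, h.ne']

/-- `ξ` is orthogonal to the hyperplane `ρ(ℝ^d × 0)`. -/
theorem normalField_orthogonal (d : ℕ) (m : ℝ) (ρ : E (d + 1) ≃ₗᵢ[ℝ] E (d + 1))
    (x : E (d + 1)) (y : E d) :
    metricForm (schwarzschildMetric (d + 1) m) x (normalField d m ρ x) (chart d ρ y) = 0 := by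
  rw [metricForm_schwarzschild, normalField, chart, real_inner_smul_left,
    LinearIsometryEquiv.inner_map_map, basisVec, EuclideanSpace.inner_single_left]
  simp

end Schwarzschild

end

/-! Write `n = k + 2` and `r = |x|`. The metric is `F(r) δ` with `F' = 2 r β F`. Both the hyperplane
and the horizon are totally geodesic, so `Q` contains no second fundamental form. After
multiplication by the volume density, the Jacobi operator becomes the Euclidean expression `div(P
∇u) + V P u`, where `P = F^((k-1)/2)` and `V = F Ric(ξ, ξ)`.

Stability follows from a positive supersolution, `w = 1 / (r √F)`, the reciprocal of the area
radius. Its logarithmic gradient is `-κ y` with `κ = (1 + r² β) / r²`. A Riccati equation for `P κ`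
shows that `w` satisfies `div(P ∇w) + V P w = -(k - 2) P r² κ² w`, which is nonpositive exactly
because `n ≥ 4`. The area radius is critical at the horizon, so `κ(R₀) = 0` and `w` satisfies the
Neumann condition there.

Only `κ` enters the proof, not `w` itself. For the field `X = P (u ∇u + u² κ y)`, completing the
square gives `div X = u (div(P ∇u) + V P u) + P |∇u + u κ y|² + (k - 2) P u² r² κ²`
(`mul_jacobi_le_divergence`). The flux of `X` vanishes on `|y| = R` because `u` does, and on the
horizon it is the boundary term of `Q` because `κ(R₀) = 0`. Hence `Q(u, u) ≥ 0`
(`indexForm_nonneg`), and no nonzero space can be negative definite.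

The analytic input is the divergence theorem on a spherical shell for fields that are `C¹` only up
to the boundary (`integral_divergence_shell`). It is obtained from radial test functions, polar
coordinates and a one-dimensional weak-derivative lemma. -/

noncomputable section

namespace Schwarzschild

/-! ### Weak derivatives on an interval -/

/-- A continuous function whose weak derivative on `(a, b)` is a continuous function satisfies
the fundamental theorem of calculus. -/
theorem sub_eq_integral_of_weak_deriv {a b : ℝ} (hab : a < b) {Φ D : ℝ → ℝ}
    (hΦ : Continuous Φ) (hD : Continuous D)
    (h : ∀ χ : ℝ → ℝ, ContDiff ℝ ∞ χ → tsupport χ ⊆ Set.Ioo a b →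
      ∫ x in a..b, χ x * D x = -∫ x in a..b, deriv χ x * Φ x) :
    Φ b - Φ a = ∫ x in a..b, D x := by
  set Ψ : ℝ → ℝ := fun x => Φ x - ∫ t in a..x, D t with hΨdef
  have hprim : ∀ x, HasDerivAt (fun x => ∫ t in a..x, D t) (D x) x := fun x =>
    intervalIntegral.integral_hasDerivAt_right (hD.intervalIntegrable _ _)
      hD.stronglyMeasurable.stronglyMeasurableAtFilter hD.continuousAt
  have hprimc : Continuous (fun x => ∫ t in a..x, D t) :=
    continuous_iff_continuousAt.2 fun x => (hprim x).continuousAt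
  -- `Ψ` has zero weak derivative, and the rest of the proof shows that it is constant (du
  -- Bois-Reymond).
  have hΨ : Continuous Ψ := hΦ.sub hprimc
  have hweak : ∀ χ : ℝ → ℝ, ContDiff ℝ ∞ χ → tsupport χ ⊆ Set.Ioo a b →
      ∫ x in a..b, deriv χ x * Ψ x = 0 := by
    intro χ hχ hsupp
    have hχc : Continuous (deriv χ) := hχ.continuous_deriv (by simp)
    have ha : χ a = 0 := image_eq_zero_of_notMem_tsupport fun hmem => (hsupp hmem).1.false
    have hb : χ b = 0 := image_eq_zero_of_notMem_tsupport fun hmem => (hsupp hmem).2.false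
    have hparts := intervalIntegral.integral_mul_deriv_eq_deriv_mul
      (u := χ) (u' := deriv χ) (v := fun x => ∫ t in a..x, D t) (v' := D) (a := a) (b := b)
      (fun x _ => (hχ.differentiable (by simp) x).hasDerivAt) (fun x _ => hprim x)
      (hχc.intervalIntegrable _ _) (hD.intervalIntegrable _ _)
    rw [ha, hb, h χ hχ hsupp] at hparts
    have : ∀ x, deriv χ x * Ψ x = deriv χ x * Φ x - deriv χ x * ∫ t in a..x, D t :=
      fun x => by simp only [hΨdef]; ring
    simp_rw [this]
    rw [intervalIntegral.integral_sub]
    · linarith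
    · exact (hχc.mul hΦ).intervalIntegrable _ _
    · exact (hχc.mul hprimc).intervalIntegrable _ _
  obtain ⟨η, hηsupp, hηs, hηint⟩ : ∃ η : ℝ → ℝ, tsupport η ⊆ Set.Ioo a b ∧ ContDiff ℝ ∞ η ∧
      ∫ x in a..b, η x = 1 := by
    have hr : 0 < (b - a) / 4 := by linarith
    let f : ContDiffBump ((a + b) / 2) := ⟨(b - a) / 8, (b - a) / 4, by linarith, by linarith⟩
    refine ⟨f.normed volume, ?_, f.contDiff_normed, ?_⟩
    · rw [f.tsupport_normed_eq]
      intro x hx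
      rw [Metric.mem_closedBall, Real.dist_eq, abs_le] at hx
      have : f.rOut = (b - a) / 4 := rfl
      rw [this] at hx
      constructor <;> linarith [hx.1, hx.2]
    · rw [← f.integral_normed (μ := volume), intervalIntegral.integral_of_le hab.le,
        setIntegral_eq_integral_of_forall_compl_eq_zero]
      intro x hx
      by_contra hne
      have hx' : x ∈ Metric.ball ((a + b) / 2) f.rOut := by
        rw [← f.support_normed_eq (μ := volume)]; exact hne
      have : f.rOut = (b - a) / 4 := rfl
      rw [Metric.mem_ball, Real.dist_eq, abs_lt, this] at hx'
      exact hx ⟨by linarith [hx'.1], by linarith [hx'.2]⟩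
  -- The only possible value of the constant is the mean of `Ψ` against the unit-mass bump `η`.
  set c := ∫ x in a..b, η x * Ψ x with hc
  have key : ∀ g : ℝ → ℝ, ContDiff ℝ ∞ g → HasCompactSupport g → tsupport g ⊆ Set.Ioo a b →
      ∫ x, g x • (Ψ x - c) = 0 := by
    intro g hg _ hgs
    set I := ∫ x in a..b, g x with hI
    -- Subtracting `I * η` makes the total integral zero, so the primitive of `q` is compactly
    -- supported in `(a, b)` and is itself a legitimate test function with derivative `q`.
    set q : ℝ → ℝ := fun x => g x - I * η x with hq
    have hqs : ContDiff ℝ ∞ q := hg.sub (contDiff_const.mul hηs)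
    have hqt : tsupport q ⊆ tsupport g ∪ tsupport η := by
      refine closure_minimal ?_ ((isClosed_tsupport _).union (isClosed_tsupport _))
      intro x hx
      by_contra hn
      rw [Set.mem_union, not_or] at hn
      apply hx
      simp [hq, image_eq_zero_of_notMem_tsupport hn.1, image_eq_zero_of_notMem_tsupport hn.2]
    have hqI : tsupport q ⊆ Set.Ioo a b := hqt.trans (Set.union_subset hgs hηsupp)
    have hqd : ∀ x, HasDerivAt (fun x => ∫ t in a..x, q t) (q x) x := fun x =>
      intervalIntegral.integral_hasDerivAt_right (hqs.continuous.intervalIntegrable _ _)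
        hqs.continuous.stronglyMeasurable.stronglyMeasurableAtFilter hqs.continuous.continuousAt
    have hderiv : deriv (fun x => ∫ t in a..x, q t) = q := funext fun x => (hqd x).deriv
    have hqint : ∫ x in a..b, q x = 0 := by
      simp only [hq]
      rw [intervalIntegral.integral_sub, intervalIntegral.integral_const_mul, hηint]
      · simp [hI]
      · exact hg.continuous.intervalIntegrable _ _
      · exact (continuous_const.mul hηs.continuous).intervalIntegrable _ _
    have hχs : ContDiff ℝ ∞ (fun x => ∫ t in a..x, q t) := by
      rw [contDiff_infty_iff_deriv, hderiv]
      exact ⟨fun x => (hqd x).differentiableAt, hqs⟩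
    have hcomp : IsCompact (tsupport q) :=
      Metric.isCompact_of_isClosed_isBounded (isClosed_tsupport _)
        ((Metric.isBounded_Ioo a b).subset hqI)
    obtain ⟨a', b', ha', hb', hsub⟩ : ∃ a' b', a < a' ∧ b' < b ∧ tsupport q ⊆ Set.Icc a' b' := by
      rcases (tsupport q).eq_empty_or_nonempty with he | hne
      · exact ⟨a + 1, b - 1, by linarith, by linarith, by simp [he]⟩
      · obtain ⟨x, hx, hxm⟩ := hcomp.exists_isLeast hne
        obtain ⟨y, hy, hym⟩ := hcomp.exists_isGreatest hne
        exact ⟨x, y, (hqI hx).1, (hqI hy).2, fun z hz => ⟨hxm hz, hym hz⟩⟩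
    have hzero : ∀ x, x ∉ Set.Icc a' b' → q x = 0 := fun x hx =>
      image_eq_zero_of_notMem_tsupport fun hm => hx (hsub hm)
    have hχt : tsupport (fun x => ∫ t in a..x, q t) ⊆ Set.Ioo a b := by
      refine (closure_minimal ?_ isClosed_Icc : _ ⊆ Set.Icc a' b').trans
        fun x hx => ⟨by linarith [hx.1], by linarith [hx.2]⟩
      intro x hx
      by_contra hn
      apply hx
      rw [Set.mem_Icc, not_and_or, not_le, not_le] at hn
      rcases hn with hn | hn
      · refine intervalIntegral.integral_zero_ae (.of_forall fun t ht => hzero t fun ht' => ?_)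
        have := ht.2
        rcases max_cases a x with h' | h' <;> linarith [ht'.1]
      · have hxb : ∫ t in x..b, q t = 0 := by
          refine intervalIntegral.integral_zero_ae (.of_forall fun t ht => hzero t fun ht' => ?_)
          have := ht.1
          rcases min_cases x b with h' | h' <;> linarith [ht'.2]
        have := intervalIntegral.integral_add_adjacent_intervals
          (hqs.continuous.intervalIntegrable (μ := volume) a x)
          (hqs.continuous.intervalIntegrable x b)
        linarith
    have h0 := hweak _ hχs hχt
    rw [hderiv] at h0
    have hexp : ∀ x, q x * Ψ x = g x * Ψ x - I * (η x * Ψ x) := fun x => by simp only [hq]; ring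
    simp_rw [hexp] at h0
    have hgΨ : IntervalIntegrable (fun x => g x * Ψ x) volume a b :=
      (hg.continuous.mul hΨ).intervalIntegrable _ _
    have hηΨ : IntervalIntegrable (fun x => I * (η x * Ψ x)) volume a b :=
      (continuous_const.mul (hηs.continuous.mul hΨ)).intervalIntegrable _ _
    have hgc : IntervalIntegrable (fun x => g x * c) volume a b :=
      (hg.continuous.mul continuous_const).intervalIntegrable _ _
    rw [intervalIntegral.integral_sub hgΨ hηΨ, intervalIntegral.integral_const_mul, ← hc] at h0
    have hset : ∫ x, g x • (Ψ x - c) = ∫ x in a..b, (g x * Ψ x - g x * c) := by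
      rw [intervalIntegral.integral_of_le hab.le,
        setIntegral_eq_integral_of_forall_compl_eq_zero]
      · simp [mul_sub]
      · intro x hx
        have : g x = 0 := image_eq_zero_of_notMem_tsupport fun hm =>
          hx ⟨(hgs hm).1, (hgs hm).2.le⟩
        simp [this]
    rw [hset, intervalIntegral.integral_sub hgΨ hgc, intervalIntegral.integral_mul_const, ← hI]
    exact h0
  -- The fundamental lemma gives `Ψ = c` almost everywhere. Continuity upgrades this to all of `(a,
  -- b)` and then, by closure, to both endpoints.
  have hae := isOpen_Ioo.ae_eq_zero_of_integral_contDiff_smul_eq_zero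
    (μ := volume) (f := fun x => Ψ x - c)
    ((hΨ.sub continuous_const).locallyIntegrable.locallyIntegrableOn _) key
  have heq : Set.EqOn (fun x => Ψ x - c) (fun _ => 0) (Set.Ioo a b) := by
    refine Measure.eqOn_open_of_ae_eq (μ := volume) ?_ isOpen_Ioo
      (hΨ.sub continuous_const).continuousOn continuousOn_const
    exact (ae_restrict_iff' measurableSet_Ioo).2 hae
  have heq' := heq.closure (hΨ.sub continuous_const) continuous_const
  rw [closure_Ioo hab.ne] at heq'
  have h1 := heq' (Set.left_mem_Icc.2 hab.le)
  have h2 := heq' (Set.right_mem_Icc.2 hab.le)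
  simp only [hΨdef, intervalIntegral.integral_same] at h1 h2
  linarith

/-! ### Spherical shells, polar coordinates and radial functions -/

/-- The closed spherical shell `a ≤ |y| ≤ b`. -/
def shell (d : ℕ) (a b : ℝ) : Set (E d) := {y | a ≤ ‖y‖ ∧ ‖y‖ ≤ b}

theorem isClosed_shell (d : ℕ) (a b : ℝ) : IsClosed (shell d a b) :=
  (isClosed_le continuous_const continuous_norm).inter
    (isClosed_le continuous_norm continuous_const)

theorem isCompact_shell (d : ℕ) (a b : ℝ) : IsCompact (shell d a b) :=
  Metric.isCompact_of_isClosed_isBounded (isClosed_shell d a b)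
    ((Metric.isBounded_closedBall (x := (0 : E d)) (r := b)).subset fun y hy => by
      simpa using hy.2)

theorem smul_mem_shell_iff {d : ℕ} {a b r : ℝ} (hr : 0 ≤ r) (θ : Metric.sphere (0 : E d) 1) :
    r • (θ : E d) ∈ shell d a b ↔ r ∈ Set.Icc a b := by
  have : ‖r • (θ : E d)‖ = r := by simp [norm_smul, abs_of_nonneg hr]
  simp [shell, this]

/-- Integration in polar coordinates over a spherical shell. -/
theorem setIntegral_shell_eq_polar {d : ℕ} (hd : 0 < d) {a b : ℝ} (ha : 0 < a) (hab : a ≤ b)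
    {H : E d → ℝ} (hH : ContinuousOn H (shell d a b)) :
    ∫ y in shell d a b, H y =
      ∫ r in a..b, r ^ (d - 1) * ∫ θ : Metric.sphere (0 : E d) 1, H (r • (θ : E d))
        ∂(volume : Measure (E d)).toSphere := by
  have : Nonempty (Fin d) := ⟨⟨0, hd⟩⟩
  have : Nontrivial (E d) := inferInstance
  have hdim : Module.finrank ℝ (E d) = d := by simp
  set μ : Measure (E d) := volume
  -- Extension by zero makes the polar decomposition of the whole punctured space applicable. The
  -- radii outside `[a, b]` are discarded at the end.
  set F : E d → ℝ := (shell d a b).indicator H with hF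
  have hFint : Integrable F :=
    (hH.integrableOn_compact (isCompact_shell d a b)).integrable_indicator
      (isClosed_shell d a b).measurableSet
  have hmp := μ.measurePreserving_homeomorphUnitSphereProd
  rw [hdim] at hmp
  have hemb := (homeomorphUnitSphereProd (E d)).measurableEmbedding
  have hval : ∀ p : ({0}ᶜ : Set (E d)), F p = (fun q : Metric.sphere (0 : E d) 1 × Set.Ioi (0 : ℝ) =>
      F ((q.2 : ℝ) • (q.1 : E d))) (homeomorphUnitSphereProd (E d) p) := by
    intro p
    have : (p : E d) ≠ 0 := p.2
    simp [smul_smul, this]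
  have hint1 : Integrable (fun p : ({0}ᶜ : Set (E d)) => F p) (μ.comap (↑)) := by
    have := (integrableOn_iff_comap_subtypeVal (μ := μ) (f := F)
      (measurableSet_singleton (0 : E d)).compl).1 hFint.integrableOn
    exact this
  have hint2 : Integrable (fun q : Metric.sphere (0 : E d) 1 × Set.Ioi (0 : ℝ) =>
      F ((q.2 : ℝ) • (q.1 : E d))) (μ.toSphere.prod (.volumeIoiPow (d - 1))) := by
    rw [← hmp.integrable_comp_emb hemb]
    exact hint1.congr (.of_forall hval)
  calc ∫ y in shell d a b, H y = ∫ y, F y :=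
        (integral_indicator (isClosed_shell d a b).measurableSet).symm
    _ = ∫ p : ({0}ᶜ : Set (E d)), F p ∂(μ.comap (↑)) := by
        rw [integral_subtype_comap (measurableSet_singleton _).compl F, restrict_compl_singleton]
    _ = ∫ q, F ((q.2 : ℝ) • (q.1 : E d)) ∂(μ.toSphere.prod (.volumeIoiPow (d - 1))) := by
        rw [← hmp.integral_comp hemb]
        exact integral_congr_ae (.of_forall hval)
    _ = ∫ r, ∫ θ, F ((r : ℝ) • (θ : E d)) ∂μ.toSphere ∂(Measure.volumeIoiPow (d - 1)) :=
        integral_prod_symm _ hint2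
    _ = ∫ r in Set.Ioi (0 : ℝ), r ^ (d - 1) * ∫ θ, F (r • (θ : E d)) ∂μ.toSphere := by
        simp only [Measure.volumeIoiPow, ENNReal.ofReal]
        rw [integral_withDensity_eq_integral_smul,
          integral_subtype_comap measurableSet_Ioi fun r : ℝ =>
            Real.toNNReal (r ^ (d - 1)) • ∫ θ, F (r • (θ : E d)) ∂μ.toSphere,
          setIntegral_congr_fun measurableSet_Ioi fun r hr => ?_]
        · simp only [NNReal.smul_def, smul_eq_mul]
          rw [Real.coe_toNNReal _ (pow_nonneg (le_of_lt hr) _)]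
        · exact (measurable_subtype_coe.pow_const _).real_toNNReal
    _ = ∫ r in Set.Icc a b, r ^ (d - 1) * ∫ θ, F (r • (θ : E d)) ∂μ.toSphere := by
        refine setIntegral_eq_of_subset_of_forall_sdiff_eq_zero measurableSet_Ioi
          (fun r hr => lt_of_lt_of_le ha hr.1) fun r hr => ?_
        have : ∀ θ : Metric.sphere (0 : E d) 1, F (r • (θ : E d)) = 0 := fun θ =>
          Set.indicator_of_notMem
            (fun hm => hr.2 ((smul_mem_shell_iff (le_of_lt hr.1) θ).1 hm)) _
        simp [this]
    _ = ∫ r in Set.Icc a b, r ^ (d - 1) * ∫ θ, H (r • (θ : E d)) ∂μ.toSphere := by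
        refine setIntegral_congr_fun measurableSet_Icc fun r hr => ?_
        have : ∀ θ : Metric.sphere (0 : E d) 1, F (r • (θ : E d)) = H (r • (θ : E d)) := fun θ =>
          Set.indicator_of_mem ((smul_mem_shell_iff (ha.le.trans hr.1) θ).2 hr) _
        simp [this]
    _ = _ := by
        rw [intervalIntegral.integral_of_le hab, integral_Icc_eq_integral_Ioc]

/-- The derivative of a radial function away from the origin. -/
theorem hasFDerivAt_comp_norm {n : ℕ} {g : ℝ → ℝ} {g' : ℝ} {x : E n} (hx : x ≠ 0)
    (hg : HasDerivAt g g' ‖x‖) :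
    HasFDerivAt (fun z : E n => g ‖z‖) ((g' / ‖x‖) • innerSL ℝ x) x := by
  have hx' : ‖x‖ ≠ 0 := norm_ne_zero_iff.2 hx
  have h1 : HasFDerivAt (fun z : E n => ‖z‖ ^ 2) (2 • innerSL ℝ x) x :=
    (hasStrictFDerivAt_norm_sq x).hasFDerivAt
  have h2 := h1.sqrt (pow_ne_zero 2 hx')
  have h3 : HasFDerivAt (fun z : E n => ‖z‖) (‖x‖⁻¹ • innerSL ℝ x) x := by
    refine (h2.congr_of_eventuallyEq (.of_forall fun z => ?_)).congr_fderiv ?_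
    · simp
    · ext v
      simp
      field_simp
  refine (hg.comp_hasFDerivAt x h3).congr_fderiv ?_
  rw [smul_smul, div_eq_mul_inv]

theorem innerSL_basisVec {n : ℕ} (x : E n) (i : Fin n) : innerSL ℝ x (basisVec i) = x i := by
  rw [innerSL_apply_apply, basisVec, EuclideanSpace.inner_single_right]
  simp

theorem pderiv_comp_norm {n : ℕ} {g : ℝ → ℝ} {g' : ℝ} {x : E n} (hx : x ≠ 0)
    (hg : HasDerivAt g g' ‖x‖) (i : Fin n) :
    pderiv i (fun z : E n => g ‖z‖) x = g' / ‖x‖ * x i := by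
  rw [pderiv, (hasFDerivAt_comp_norm hx hg).fderiv, smul_apply,
    innerSL_basisVec, smul_eq_mul]

/-- The shell is not convex, but each point lies in a convex body that is contained in the shell
near that point. Off the outer sphere it is the half-space `⟪y, z⟫ ≥ ‖y‖²`, where `‖z‖ ≥ ‖y‖` by
Cauchy-Schwarz; on the outer sphere it is the closed ball. This makes one-sided derivatives at the
boundary well defined. -/
theorem uniqueDiffOn_shell (d : ℕ) {a b : ℝ} (ha : 0 < a) (hab : a < b) :
    UniqueDiffOn ℝ (shell d a b) := by
  intro y hy
  rcases hy.2.lt_or_eq with hlt | heq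
  · have hy0 : 0 < ‖y‖ := ha.trans_le hy.1
    have hconv : Convex ℝ {z : E d | ‖y‖ ^ 2 ≤ innerSL ℝ y z} :=
      convex_halfSpace_ge (innerSL ℝ y).isLinear _
    have hint : (interior {z : E d | ‖y‖ ^ 2 ≤ innerSL ℝ y z}).Nonempty := by
      refine ⟨(2 : ℝ) • y, mem_interior.2 ⟨{z : E d | ‖y‖ ^ 2 < innerSL ℝ y z},
        fun z (hz : ‖y‖ ^ 2 < innerSL ℝ y z) => hz.le, isOpen_lt continuous_const (innerSL ℝ y).continuous, ?_⟩⟩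
      simp only [Set.mem_ofPred_eq, innerSL_apply_apply, inner_smul_right,
        real_inner_self_eq_norm_sq]
      nlinarith [pow_pos hy0 2]
    have h1 : UniqueDiffWithinAt ℝ {z : E d | ‖y‖ ^ 2 ≤ innerSL ℝ y z} y :=
      uniqueDiffWithinAt_convex hconv hint (subset_closure (by simp))
    refine (h1.inter (Metric.isOpen_ball.mem_nhds
      (show y ∈ Metric.ball (0 : E d) b by simpa using hlt))).mono ?_
    rintro z ⟨hz1, hz2⟩
    refine ⟨hy.1.trans ?_, by simpa using (mem_ball_zero_iff.1 hz2).le⟩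
    have : ‖y‖ ^ 2 ≤ ‖y‖ * ‖z‖ := le_trans hz1 (real_inner_le_norm y z)
    nlinarith
  · have h1 : UniqueDiffWithinAt ℝ (Metric.closedBall (0 : E d) b) y := by
      refine uniqueDiffWithinAt_convex (convex_closedBall _ _) ?_
        (subset_closure (by simp [heq]))
      exact ⟨0, Metric.ball_subset_interior_closedBall (by simpa using ha.trans hab)⟩
    refine (h1.inter ((isOpen_lt continuous_const continuous_norm).mem_nhds
      (show a < ‖y‖ by rw [heq]; exact hab))).mono ?_
    rintro z ⟨hz1, hz2⟩
    exact ⟨le_of_lt hz2, by simpa using hz1⟩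

theorem contDiffOn_pderivOn {d : ℕ} {a b : ℝ} (ha : 0 < a) (hab : a < b) {w : E d → ℝ}
    {k l : WithTop ℕ∞} (hw : ContDiffOn ℝ l w (shell d a b)) (hkl : k + 1 ≤ l) (i : Fin d) :
    ContDiffOn ℝ k (pderivOn (shell d a b) i w) (shell d a b) :=
  (hw.fderivWithin (uniqueDiffOn_shell d ha hab) hkl).clm_apply contDiffOn_const

/-! ### The divergence theorem on a shell -/

/-- The clamp of a real number to `[a, b]`. -/
def clamp (a b r : ℝ) : ℝ := max a (min r b)

theorem continuous_clamp (a b : ℝ) : Continuous (clamp a b) := by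
  unfold clamp; fun_prop

theorem clamp_mem {a b : ℝ} (hab : a ≤ b) (r : ℝ) : clamp a b r ∈ Set.Icc a b :=
  ⟨le_max_left _ _, max_le hab (min_le_right _ _)⟩

theorem clamp_of_mem {a b r : ℝ} (hr : r ∈ Set.Icc a b) : clamp a b r = r := by
  simp [clamp, hr.1, hr.2]

/-- The weak-derivative lemma asks for functions continuous on all of `ℝ`. Clamping the radius
extends a sphere integral by constants beyond `[a, b]`, where `H` is not controlled. -/
theorem continuous_sphere_integral_clamp {d : ℕ} {a b : ℝ} (ha : 0 < a) (hab : a ≤ b)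
    {H : E d → ℝ} (hH : ContinuousOn H (shell d a b)) :
    Continuous fun r => clamp a b r ^ (d - 1) *
      ∫ θ : Metric.sphere (0 : E d) 1, H (clamp a b r • (θ : E d))
        ∂(volume : Measure (E d)).toSphere := by
  refine ((continuous_clamp a b).pow _).mul ?_
  have hc : Continuous (Function.uncurry fun (r : ℝ) (θ : Metric.sphere (0 : E d) 1) =>
      H (clamp a b r • (θ : E d))) := by
    refine hH.comp_continuous ?_ fun p => ?_
    · exact ((continuous_clamp a b).comp continuous_fst).smul
        (continuous_subtype_val.comp continuous_snd)
    · have := clamp_mem hab p.1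
      exact (smul_mem_shell_iff (ha.le.trans this.1) p.2).2 this
  simpa using continuous_parametric_integral_of_continuous
    (μ := (volume : Measure (E d)).toSphere) hc isCompact_univ

/-- The function `χ(|y|)` is supported in the open shell, so integration by parts over the whole
space has no boundary term. The gradient of `χ(|y|)` is `χ'(|y|) y / |y|`, which turns the
right-hand side into a radial flux. -/
theorem integral_comp_norm_mul_divergence {d : ℕ} {a b : ℝ} (ha : 0 < a)
    (hab : a < b) {X : Fin d → E d → ℝ} (hX : ∀ i, ContDiffOn ℝ 1 (X i) (shell d a b))
    {χ : ℝ → ℝ} (hχ : ContDiff ℝ ∞ χ) (hsupp : tsupport χ ⊆ Set.Ioo a b) :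
    ∫ y in shell d a b, χ ‖y‖ * ∑ i, pderivOn (shell d a b) i (X i) y =
      -∫ y in shell d a b, deriv χ ‖y‖ * ∑ i, X i y * (‖y‖⁻¹ * y i) := by
  have hnz : ∀ y ∈ shell d a b, y ≠ 0 := fun y hy h0 => by
    have := hy.1; rw [h0, norm_zero] at this; linarith
  have hχz : ∀ y : E d, ‖y‖ ∉ Set.Ioo a b → χ ‖y‖ = 0 := fun y hy =>
    image_eq_zero_of_notMem_tsupport fun hm => hy (hsupp hm)
  have hts : tsupport (fun y : E d => χ ‖y‖) ⊆ {y | ‖y‖ ∈ tsupport χ} :=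
    closure_minimal (fun y hy => subset_tsupport χ hy)
      ((isClosed_tsupport χ).preimage continuous_norm)
  have hts' : tsupport (fun y : E d => χ ‖y‖) ⊆ shell d a b := fun y hy =>
    ⟨(hsupp (hts hy)).1.le, (hsupp (hts hy)).2.le⟩
  have hfd : ∀ y : E d, y ≠ 0 → HasFDerivAt (fun y : E d => χ ‖y‖)
      ((deriv χ ‖y‖ / ‖y‖) • innerSL ℝ y) y := fun y hy =>
    hasFDerivAt_comp_norm hy (hχ.differentiable (by simp) _).hasDerivAt
  have hdiff : ∀ y : E d, DifferentiableAt ℝ (fun y : E d => χ ‖y‖) y := by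
    intro y
    -- The norm is not differentiable at the origin, but `χ(|y|)` vanishes in a neighbourhood of it.
    by_cases hy : y = 0
    · have : y ∉ tsupport (fun y : E d => χ ‖y‖) := fun hm => hnz y (hts' hm) hy
      exact ((hasFDerivAt_const (0 : ℝ) y).congr_of_eventuallyEq
        (notMem_tsupport_iff_eventuallyEq.1 this)).differentiableAt
    · exact (hfd y hy).differentiableAt
  have hnhds : ∀ y : E d, ‖y‖ ∈ Set.Ioo a b → shell d a b ∈ nhds y := fun y hy =>
    mem_of_superset ((isOpen_Ioo.preimage continuous_norm).mem_nhds hy)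
      fun z hz => ⟨le_of_lt hz.1, le_of_lt hz.2⟩
  have hderχ : Continuous (deriv χ) := hχ.continuous_deriv (by simp)
  have hmeas := (isClosed_shell d a b).measurableSet
  have hinvn : ContinuousOn (fun y : E d => ‖y‖⁻¹) (shell d a b) :=
    continuous_norm.continuousOn.inv₀ fun y hy => norm_ne_zero_iff.2 (hnz y hy)
  have hcoord : ∀ i, Continuous fun y : E d => y i := fun i => by fun_prop
  -- Inside the open shell `fderiv` and `fderivWithin` agree. Elsewhere `χ` vanishes, so the
  -- uncontrolled values of `fderiv (X i)` do not matter.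
  have e1 : ∀ i (y : E d), χ ‖y‖ * fderiv ℝ (X i) y (basisVec i) =
      (shell d a b).indicator (fun y => χ ‖y‖ * pderivOn (shell d a b) i (X i) y) y := by
    intro i y
    by_cases hy : ‖y‖ ∈ Set.Ioo a b
    · rw [Set.indicator_of_mem (mem_of_mem_nhds (hnhds y hy)), pderivOn,
        fderivWithin_of_mem_nhds (hnhds y hy)]
    · rw [hχz y hy, zero_mul]
      simp [Set.indicator, hχz y hy]
  have e2 : ∀ i (y : E d), fderiv ℝ (fun y : E d => χ ‖y‖) y (basisVec i) * X i y =
      (shell d a b).indicator (fun y => deriv χ ‖y‖ * (X i y * (‖y‖⁻¹ * y i))) y := by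
    intro i y
    by_cases hy : y ∈ shell d a b
    · rw [Set.indicator_of_mem hy, (hfd y (hnz y hy)).fderiv, smul_apply,
        innerSL_basisVec, smul_eq_mul]
      ring
    · have : fderiv ℝ (fun y : E d => χ ‖y‖) y = 0 := by
        by_contra hne
        exact hy (hts' (support_fderiv_subset ℝ hne))
      rw [Set.indicator_of_notMem hy, this]
      simp
  have c1 : ∀ i, ContinuousOn (fun y => χ ‖y‖ * pderivOn (shell d a b) i (X i) y)
      (shell d a b) := fun i =>
    (hχ.continuous.comp continuous_norm).continuousOn.mul
      (contDiffOn_pderivOn (k := 0) ha hab (hX i) (by simp) i).continuousOn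
  have c2 : ∀ i, ContinuousOn (fun y => deriv χ ‖y‖ * (X i y * (‖y‖⁻¹ * y i)))
      (shell d a b) := fun i =>
    (hderχ.comp continuous_norm).continuousOn.mul
      ((hX i).continuousOn.mul (hinvn.mul (hcoord i).continuousOn))
  have i1 : ∀ i, IntegrableOn (fun y => χ ‖y‖ * pderivOn (shell d a b) i (X i) y)
      (shell d a b) := fun i => (c1 i).integrableOn_compact (isCompact_shell d a b)
  have i2 : ∀ i, IntegrableOn (fun y => deriv χ ‖y‖ * (X i y * (‖y‖⁻¹ * y i)))
      (shell d a b) := fun i => (c2 i).integrableOn_compact (isCompact_shell d a b)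
  have hparts : ∀ i, ∫ y in shell d a b, χ ‖y‖ * pderivOn (shell d a b) i (X i) y =
      -∫ y in shell d a b, deriv χ ‖y‖ * (X i y * (‖y‖⁻¹ * y i)) := by
    intro i
    rw [← integral_indicator hmeas, ← integral_indicator hmeas]
    have := integral_mul_fderiv_eq_neg_fderiv_mul_of_integrable (μ := (volume : Measure (E d)))
      (f := fun y : E d => χ ‖y‖) (g := X i) (v := basisVec i) ?_ ?_ ?_
      (fun y _ => hdiff y) ?_
    · simpa only [e1, e2] using this
    · simp only [e2]; exact (i2 i).integrable_indicator hmeas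
    · simp only [e1]; exact (i1 i).integrable_indicator hmeas
    · have : (fun y : E d => χ ‖y‖ * X i y) =
          (shell d a b).indicator (fun y => χ ‖y‖ * X i y) := by
        ext y
        by_cases hy : y ∈ shell d a b
        · rw [Set.indicator_of_mem hy]
        · rw [Set.indicator_of_notMem hy, hχz y fun h => hy ⟨h.1.le, h.2.le⟩, zero_mul]
      rw [this]
      exact (((hχ.continuous.comp continuous_norm).continuousOn.mul
        (hX i).continuousOn).integrableOn_compact
          (isCompact_shell d a b)).integrable_indicator hmeas
    · intro y hy
      exact ((hX i).contDiffAt (hnhds y (hsupp (hts hy)))).differentiableAt (by simp)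
  simp only [Finset.mul_sum]
  rw [integral_finsetSum _ fun i _ => i1 i, integral_finsetSum _ fun i _ => i2 i,
    ← Finset.sum_neg_distrib]
  exact Finset.sum_congr rfl fun i _ => hparts i

/-- The divergence theorem on a spherical shell. -/
theorem integral_divergence_shell {d : ℕ} (hd : 0 < d) {a b : ℝ} (ha : 0 < a) (hab : a < b)
    {X : Fin d → E d → ℝ} (hX : ∀ i, ContDiffOn ℝ 1 (X i) (shell d a b)) :
    ∫ y in shell d a b, ∑ i, pderivOn (shell d a b) i (X i) y =
      b ^ (d - 1) * (∫ θ : Metric.sphere (0 : E d) 1, ∑ i, X i (b • (θ : E d)) * (θ : E d) i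
        ∂(volume : Measure (E d)).toSphere) -
      a ^ (d - 1) * ∫ θ : Metric.sphere (0 : E d) 1, ∑ i, X i (a • (θ : E d)) * (θ : E d) i
        ∂(volume : Measure (E d)).toSphere := by
  set μ := (volume : Measure (E d)).toSphere
  have hdiv : ContinuousOn (fun y => ∑ i, pderivOn (shell d a b) i (X i) y) (shell d a b) :=
    continuousOn_finsetSum _ fun i _ =>
      (contDiffOn_pderivOn (k := 0) ha hab (hX i) (by simp) i).continuousOn
  have hnz : ∀ y ∈ shell d a b, ‖y‖ ≠ 0 := fun y hy => (ha.trans_le hy.1).ne'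
  have hflux : ContinuousOn (fun y : E d => ∑ i, X i y * (‖y‖⁻¹ * y i)) (shell d a b) :=
    continuousOn_finsetSum _ fun i _ => (hX i).continuousOn.mul
      ((continuous_norm.continuousOn.inv₀ hnz).mul
        (show Continuous fun y : E d => y i by fun_prop).continuousOn)
  have hθ : ∀ r : ℝ, 0 < r → ∀ (θ : Metric.sphere (0 : E d) 1) (i : Fin d),
      ‖r • (θ : E d)‖⁻¹ * (r • (θ : E d)) i = (θ : E d) i := by
    intro r hr θ i
    simp [norm_smul, abs_of_pos hr, hr.ne']
  have hnorm : ∀ r, 0 < r → ∀ θ : Metric.sphere (0 : E d) 1, ‖r • (θ : E d)‖ = r := by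
    intro r hr θ
    simp [norm_smul, abs_of_pos hr]
  -- The flux through the sphere of radius `r` has the sphere integral of the divergence as its weak
  -- derivative in `r`. Continuity up to `a` and `b` then suffices, with no extension of `X` past
  -- the boundary.
  have hmain := sub_eq_integral_of_weak_deriv hab
    (continuous_sphere_integral_clamp ha hab.le hflux)
    (continuous_sphere_integral_clamp ha hab.le hdiv) ?_
  · rw [setIntegral_shell_eq_polar hd ha hab.le hdiv]
    rw [clamp_of_mem (Set.right_mem_Icc.2 hab.le), clamp_of_mem (Set.left_mem_Icc.2 hab.le)]
      at hmain
    simp only [hθ b (ha.trans hab), hθ a ha] at hmain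
    rw [hmain]
    refine intervalIntegral.integral_congr fun r hr => ?_
    rw [Set.uIcc_of_le hab.le] at hr
    simp only [clamp_of_mem hr]
  · intro χ hχ hsupp
    have hweak := integral_comp_norm_mul_divergence ha hab hX hχ hsupp
    have hderχ : Continuous (deriv χ) := hχ.continuous_deriv (by simp)
    have c1 : ContinuousOn (fun y : E d => χ ‖y‖ * ∑ i, pderivOn (shell d a b) i (X i) y)
        (shell d a b) := (hχ.continuous.comp continuous_norm).continuousOn.mul hdiv
    have c2 : ContinuousOn (fun y : E d => deriv χ ‖y‖ * ∑ i, X i y * (‖y‖⁻¹ * y i))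
        (shell d a b) := (hderχ.comp continuous_norm).continuousOn.mul hflux
    rw [setIntegral_shell_eq_polar hd ha hab.le c1,
      setIntegral_shell_eq_polar hd ha hab.le c2] at hweak
    convert hweak using 1
    · refine intervalIntegral.integral_congr fun r hr => ?_
      rw [Set.uIcc_of_le hab.le] at hr
      simp only [clamp_of_mem hr, hnorm r (ha.trans_le hr.1), integral_const_mul]
      ring
    · congr 1
      refine intervalIntegral.integral_congr fun r hr => ?_
      rw [Set.uIcc_of_le hab.le] at hr
      simp only [clamp_of_mem hr, hnorm r (ha.trans_le hr.1), integral_const_mul]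
      ring

/-! ### Curvature of rotationally symmetric conformally flat metrics -/

theorem smul_one_inv {n : ℕ} {c : ℝ} (hc : c ≠ 0) :
    (c • (1 : Matrix (Fin n) (Fin n) ℝ))⁻¹ = c⁻¹ • 1 := by
  refine Matrix.inv_eq_right_inv ?_
  simp [smul_smul, hc]

/-- The Christoffel symbols of a conformally flat metric `F δ`. -/
theorem christoffel_conformal {n : ℕ} {F : E n → ℝ} {x : E n} (hF : F x ≠ 0) (k i j : Fin n) :
    christoffel (fun z => F z • (1 : Matrix (Fin n) (Fin n) ℝ)) k i j x =
      (if j = k then 1 else 0) * (pderiv i F x / (2 * F x)) +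
      (if i = k then 1 else 0) * (pderiv j F x / (2 * F x)) -
      (if i = j then 1 else 0) * (pderiv k F x / (2 * F x)) := by
  have hp : ∀ a b c : Fin n, pderiv c (fun z => (F z • (1 : Matrix (Fin n) (Fin n) ℝ)) a b) x =
      (if a = b then 1 else 0) * pderiv c F x := by
    intro a b c
    by_cases h : a = b
    · subst h; simp [pderiv]
    · simp [pderiv, h]
  simp only [christoffel, smul_one_inv hF, hp]
  simp only [Matrix.smul_apply, Matrix.one_apply, smul_eq_mul, mul_ite, mul_one, mul_zero,
    ite_mul, zero_mul, one_mul, Finset.sum_ite_eq, Finset.mem_univ, if_true]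
  split_ifs <;> field_simp <;> ring

/-- The contraction of the curvature expression for the Christoffel symbols
`δ_{jk} f_i + δ_{ik} f_j - δ_{ij} f_k`, where `p k i` stands for `∂_k f_i`. -/
theorem ricci_contraction {n : ℕ} (p : Fin n → Fin n → ℝ) (f : Fin n → ℝ) (i j : Fin n) :
    ∑ k, ((if j = k then 1 else 0) * p k i + (if i = k then 1 else 0) * p k j -
        (if i = j then 1 else 0) * p k k -
      (p j i + (if i = k then 1 else 0) * p j k -
        (if i = k then 1 else 0) * p j k) +
      ∑ l, (((if l = k then 1 else 0) * f k + f l -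
          (if k = l then 1 else 0) * f k) *
        ((if j = l then 1 else 0) * f i + (if i = l then 1 else 0) * f j -
          (if i = j then 1 else 0) * f l) -
        ((if l = k then 1 else 0) * f j + (if j = k then 1 else 0) * f l -
          (if j = l then 1 else 0) * f k) *
        ((if k = l then 1 else 0) * f i + (if i = l then 1 else 0) * f k -
          (if i = k then 1 else 0) * f l))) =
    p j i + p i j - n * p j i - (if i = j then 1 else 0) * ∑ k, p k k +
      (n - 2) * (f i * f j) - (n - 2) * (if i = j then 1 else 0) * ∑ l, f l * f l := by
  -- The two Kronecker terms of the first factor cancel and leave `f l`. The sum is therefore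
  -- independent of `k`, and the outer sum multiplies it by `n`.
  have h1 : ∀ k, ∑ l, (((if l = k then 1 else 0) * f k + f l -
          (if k = l then 1 else 0) * f k) *
        ((if j = l then 1 else 0) * f i + (if i = l then 1 else 0) * f j -
          (if i = j then 1 else 0) * f l)) =
      2 * (f i * f j) - (if i = j then 1 else 0) * ∑ l, f l * f l := by
    intro k
    have : ∀ l, (((if l = k then 1 else 0) * f k + f l -
          (if k = l then 1 else 0) * f k) *
        ((if j = l then 1 else 0) * f i + (if i = l then 1 else 0) * f j -
          (if i = j then 1 else 0) * f l)) =
        (if j = l then f i * f l else 0) + (if i = l then f j * f l else 0) -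
          (if i = j then 1 else 0) * (f l * f l) := by
      intro l
      simp only [eq_comm (a := l) (b := k)]
      split_ifs <;> ring
    simp only [this, Finset.sum_sub_distrib, Finset.sum_add_distrib, Finset.sum_ite_eq,
      Finset.mem_univ, if_true, ← Finset.mul_sum]
    ring
  have h2 : ∑ k, ∑ l, (((if l = k then 1 else 0) * f j + (if j = k then 1 else 0) * f l -
          (if j = l then 1 else 0) * f k) *
        ((if k = l then 1 else 0) * f i + (if i = l then 1 else 0) * f k -
          (if i = k then 1 else 0) * f l)) =
      (n + 2) * (f i * f j) - 2 * ((if i = j then 1 else 0) * ∑ l, f l * f l) := by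
    have h3 : ∀ k, ∑ l, (((if l = k then 1 else 0) * f j + (if j = k then 1 else 0) * f l -
          (if j = l then 1 else 0) * f k) *
        ((if k = l then 1 else 0) * f i + (if i = l then 1 else 0) * f k -
          (if i = k then 1 else 0) * f l)) =
        f i * f j + (if j = k then 2 * (f i * f k) else 0) -
          (if j = k then f i * f k else 0) + (if i = k then f j * f k else 0)
          - (if i = j then f k * f k else 0)
          - (if i = k then f j * f k else 0) - (if j = k then if i = k then 1 else 0 else 0) *
            (∑ l, f l * f l) + (if i = k then f k * f j else 0) := by
      intro k
      have : ∀ l, (((if l = k then 1 else 0) * f j + (if j = k then 1 else 0) * f l -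
          (if j = l then 1 else 0) * f k) *
        ((if k = l then 1 else 0) * f i + (if i = l then 1 else 0) * f k -
          (if i = k then 1 else 0) * f l)) =
        (if k = l then f j * f i else 0) + (if k = l then if i = k then f j * f k else 0 else 0)
        - (if k = l then if i = k then f j * f k else 0 else 0)
        + (if k = l then if j = k then f i * f k else 0 else 0)
        + (if i = l then if j = k then f i * f k else 0 else 0)
        - (if j = k then if i = k then 1 else 0 else 0) * (f l * f l)
        - (if k = l then if j = k then f i * f k else 0 else 0)
        - (if i = l then if i = j then f k * f k else 0 else 0)
        + (if j = l then if i = k then f k * f j else 0 else 0) := by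
        intro l
        simp only [eq_comm (a := l) (b := k)]
        by_cases e1 : k = l <;> by_cases e2 : j = k <;> by_cases e3 : i = k <;>
          by_cases e4 : i = l <;> by_cases e5 : j = l <;> simp_all <;> grind
      simp only [this, Finset.sum_sub_distrib, Finset.sum_add_distrib, Finset.sum_ite_eq,
        Finset.mem_univ, if_true, ← Finset.mul_sum]
      split_ifs <;> ring
    simp only [h3, Finset.sum_sub_distrib, Finset.sum_add_distrib, Finset.sum_ite_eq,
        Finset.mem_univ, if_true, ← Finset.sum_mul, Finset.sum_const, Finset.card_univ,
        Fintype.card_fin, nsmul_eq_mul]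
    split_ifs <;> simp <;> ring
  simp only [Finset.sum_add_distrib, Finset.sum_sub_distrib, h2, h1]
  simp only [if_true, ite_mul, one_mul, zero_mul, Finset.sum_ite_eq, Finset.mem_univ,
    Finset.sum_const, Finset.card_univ, Fintype.card_fin, nsmul_eq_mul]
  split_ifs <;> simp <;> ring

section Radial

variable {n : ℕ} {F β : ℝ → ℝ}

/-- The Christoffel symbols of a rotationally symmetric conformally flat metric, where
`F' = 2 r β F`. -/
theorem christoffel_radial (hF : ∀ r, 0 < r → F r ≠ 0)
    (hF' : ∀ r, 0 < r → HasDerivAt F (2 * F r * (r * β r)) r) {x : E n} (hx : x ≠ 0)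
    (k i j : Fin n) :
    christoffel (fun z => F ‖z‖ • (1 : Matrix (Fin n) (Fin n) ℝ)) k i j x =
      (if j = k then 1 else 0) * (β ‖x‖ * x i) + (if i = k then 1 else 0) * (β ‖x‖ * x j) -
      (if i = j then 1 else 0) * (β ‖x‖ * x k) := by
  have hr : 0 < ‖x‖ := norm_pos_iff.2 hx
  have hp : ∀ l, pderiv l (fun z : E n => F ‖z‖) x / (2 * F ‖x‖) = β ‖x‖ * x l := by
    intro l
    rw [pderiv_comp_norm hx (hF' _ hr)]
    have := hF _ hr
    field_simp
  rw [christoffel_conformal (F := fun z => F ‖z‖) (hF _ hr)]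
  simp only [hp]

/-- Writing the metric as `e^{2f} δ`, one has `∇f = β x`. This is the usual conformal change of
connection, with correction `df(v) Y + df(Y) v - ⟪v, Y⟫ ∇f`. -/
theorem covDeriv_radial (hF : ∀ r, 0 < r → F r ≠ 0)
    (hF' : ∀ r, 0 < r → HasDerivAt F (2 * F r * (r * β r)) r) {x : E n} (hx : x ≠ 0)
    (Y : E n → E n) (v : E n) :
    covDeriv (fun z => F ‖z‖ • (1 : Matrix (Fin n) (Fin n) ℝ)) Y x v =
      fderiv ℝ Y x v + (β ‖x‖ * inner ℝ x v) • Y x + (β ‖x‖ * inner ℝ x (Y x)) • v -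
        (β ‖x‖ * inner ℝ v (Y x)) • x := by
  ext k
  have hs : ∀ i, ∑ j, ((if j = k then 1 else 0) * (β ‖x‖ * x i) +
      (if i = k then 1 else 0) * (β ‖x‖ * x j) -
      (if i = j then 1 else 0) * (β ‖x‖ * x k)) * v i * Y x j =
      β ‖x‖ * (x i * v i) * Y x k +
        (if i = k then β ‖x‖ * v k * ∑ j, x j * Y x j else 0) - β ‖x‖ * (v i * Y x i) * x k := by
    intro i
    simp only [sub_mul, add_mul, Finset.sum_sub_distrib, Finset.sum_add_distrib, ite_mul, one_mul,
      zero_mul, Finset.sum_ite_eq, Finset.sum_ite_eq', Finset.mem_univ, if_true]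
    by_cases h : i = k
    · subst h
      simp only [if_true, Finset.mul_sum]
      congr 1
      · congr 1
        · ring
        · exact Finset.sum_congr rfl fun j _ => by ring
      · ring
    · simp only [h, if_false, Finset.sum_const_zero]
      ring
  simp only [covDeriv, christoffel_radial hF hF' hx, hs, Finset.sum_sub_distrib,
    Finset.sum_add_distrib, Finset.sum_ite_eq', Finset.mem_univ, if_true, PiLp.sub_apply,
    PiLp.add_apply, PiLp.smul_apply, smul_eq_mul, PiLp.inner_apply, RCLike.inner_apply, conj_trivial]
  simp only [← Finset.sum_mul, ← Finset.mul_sum]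
  have e1 : ∑ i, v i * x i = ∑ i, x i * v i := Finset.sum_congr rfl fun i _ => mul_comm _ _
  have e2 : ∑ i, Y x i * x i = ∑ i, x i * Y x i := Finset.sum_congr rfl fun i _ => mul_comm _ _
  have e3 : ∑ i, Y x i * v i = ∑ i, v i * Y x i := Finset.sum_congr rfl fun i _ => mul_comm _ _
  rw [e1, e2, e3]
  ring

theorem hasFDerivAt_radial_coord {β' : ℝ} {x : E n} (hx : x ≠ 0) (hβ : HasDerivAt β β' ‖x‖)
    (i : Fin n) :
    HasFDerivAt (fun z : E n => β ‖z‖ * z i)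
      (β ‖x‖ • (EuclideanSpace.proj i : E n →L[ℝ] ℝ) + x i • ((β' / ‖x‖) • innerSL ℝ x)) x :=
  (hasFDerivAt_comp_norm hx hβ).mul (EuclideanSpace.proj i : E n →L[ℝ] ℝ).hasFDerivAt

/-- `ricci_contraction` is applied with `f_i = β x_i` and its Jacobian `p k i = β δ_{ik} + (β' / r)
x_i x_k`, which is symmetric. -/
theorem ricciComp_radial (hF : ∀ r, 0 < r → F r ≠ 0)
    (hF' : ∀ r, 0 < r → HasDerivAt F (2 * F r * (r * β r)) r) {x : E n} (hx : x ≠ 0) {β' : ℝ}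
    (hβ : HasDerivAt β β' ‖x‖) (i j : Fin n) :
    ricciComp (fun z => F ‖z‖ • (1 : Matrix (Fin n) (Fin n) ℝ)) i j x =
      -((n - 2) * (β' / ‖x‖ - β ‖x‖ ^ 2)) * (x i * x j) -
        (if i = j then 1 else 0) *
          ((2 * n - 2) * β ‖x‖ + (β' / ‖x‖ + (n - 2) * β ‖x‖ ^ 2) * ∑ l, x l * x l) := by
  set p : Fin n → Fin n → ℝ := fun k i => β ‖x‖ * (if i = k then 1 else 0) + β' / ‖x‖ * (x i * x k)
    with hp
  have hder : ∀ c k i j, pderiv c (christoffel (fun z => F ‖z‖ • (1 : Matrix (Fin n) (Fin n) ℝ))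
      k i j) x = (if j = k then 1 else 0) * p c i + (if i = k then 1 else 0) * p c j -
      (if i = j then 1 else 0) * p c k := by
    intro c k i j
    -- The closed form of the Christoffel symbols holds only off the origin, an open set, which is
    -- enough for differentiating them at `x`.
    have heq : christoffel (fun z => F ‖z‖ • (1 : Matrix (Fin n) (Fin n) ℝ)) k i j =ᶠ[nhds x]
        fun z => (if j = k then 1 else 0) * (β ‖z‖ * z i) +
          (if i = k then 1 else 0) * (β ‖z‖ * z j) - (if i = j then 1 else 0) * (β ‖z‖ * z k) :=
      (isOpen_ne.eventually_mem hx).mono fun z hz => christoffel_radial hF hF' hz k i j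
    have hpc : ∀ a : Fin n, (β ‖x‖ • (EuclideanSpace.proj a : E n →L[ℝ] ℝ) +
        x a • ((β' / ‖x‖) • innerSL ℝ x)) (basisVec c) = p c a := by
      intro a
      rw [add_apply, smul_apply, smul_apply, smul_apply, innerSL_basisVec]
      have : (EuclideanSpace.proj a : E n →L[ℝ] ℝ) (basisVec c) = if a = c then 1 else 0 := by
        simp [basisVec]
      rw [this]
      simp only [hp, smul_eq_mul]
      ring
    have hfd := (((hasFDerivAt_radial_coord hx hβ i).const_mul (if j = k then 1 else 0)).add
      ((hasFDerivAt_radial_coord hx hβ j).const_mul (if i = k then 1 else 0))).sub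
      ((hasFDerivAt_radial_coord hx hβ k).const_mul (if i = j then 1 else 0))
    rw [pderiv, (hfd.congr_of_eventuallyEq heq).fderiv, ← hpc i, ← hpc j, ← hpc k]
    rfl
  simp only [ricciComp, hder, christoffel_radial hF hF' hx, if_true, one_mul]
  rw [ricci_contraction p (fun l => β ‖x‖ * x l)]
  have h1 : ∑ k, p k k = n * β ‖x‖ + β' / ‖x‖ * ∑ l, x l * x l := by
    simp [hp, Finset.sum_add_distrib, Finset.mul_sum]
  have h2 : ∑ l, β ‖x‖ * x l * (β ‖x‖ * x l) = β ‖x‖ ^ 2 * ∑ l, x l * x l := by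
    rw [Finset.mul_sum]
    exact Finset.sum_congr rfl fun l _ => by ring
  rw [h1, h2]
  simp only [hp, eq_comm (a := j) (b := i)]
  ring

/-- Away from the origin, the Ricci curvature in a direction orthogonal to the radial one. -/
theorem ricci_radial (hF : ∀ r, 0 < r → F r ≠ 0)
    (hF' : ∀ r, 0 < r → HasDerivAt F (2 * F r * (r * β r)) r) {x : E n} (hx : x ≠ 0) {β' : ℝ}
    (hβ : HasDerivAt β β' ‖x‖) {v : E n} (hv : inner ℝ x v = 0) :
    ricci (fun z => F ‖z‖ • (1 : Matrix (Fin n) (Fin n) ℝ)) x v v =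
      -((2 * n - 2) * β ‖x‖ + ‖x‖ * β' + (n - 2) * (‖x‖ * β ‖x‖) ^ 2) * ‖v‖ ^ 2 := by
  have hr : ‖x‖ ≠ 0 := norm_ne_zero_iff.2 hx
  have hxx : ∑ l, x l * x l = ‖x‖ ^ 2 := by
    rw [EuclideanSpace.real_norm_sq_eq]
    exact Finset.sum_congr rfl fun l _ => by ring
  have hvv : ∑ l, v l * v l = ‖v‖ ^ 2 := by
    rw [EuclideanSpace.real_norm_sq_eq]
    exact Finset.sum_congr rfl fun l _ => by ring
  have hxv : ∑ l, v l * x l = 0 := by simpa [PiLp.inner_apply] using hv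
  simp only [ricci, ricciComp_radial hF hF' hx hβ, hxx]
  set A := -((n - 2) * (β' / ‖x‖ - β ‖x‖ ^ 2))
  set B := (2 * n - 2) * β ‖x‖ + (β' / ‖x‖ + (n - 2) * β ‖x‖ ^ 2) * ‖x‖ ^ 2 with hB
  have hj : ∀ i, ∑ j, (A * (x i * x j) - (if i = j then 1 else 0) * B) * v i * v j =
      A * (v i * x i) * (∑ j, v j * x j) - B * (v i * v i) := by
    intro i
    simp only [sub_mul, Finset.sum_sub_distrib, ite_mul, one_mul, zero_mul, Finset.sum_ite_eq,
      Finset.mem_univ, if_true, Finset.mul_sum]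
    congr 1
    · exact Finset.sum_congr rfl fun j _ => by ring
    · ring
  simp only [hj, hxv, mul_zero, zero_sub, Finset.sum_neg_distrib, ← Finset.mul_sum, hvv]
  rw [hB]
  field_simp
  ring

end Radial

/-! ### The Schwarzschild profile and its curvature -/

/-- The conformal factor of the Schwarzschild metric on `ℝ^{k+2}` as a function of `r = |x|`. -/
def conformalProfile (k : ℕ) (m r : ℝ) : ℝ := (1 + m / (2 * r ^ k)) ^ (4 / (k : ℝ))

/-- Half the logarithmic derivative of the conformal factor, divided by `r`. -/
def logSlope (k : ℕ) (m r : ℝ) : ℝ := -m / (r ^ 2 * (r ^ k + m / 2))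

theorem conformalFactor_eq_profile (k : ℕ) (m : ℝ) (x : E (k + 2)) :
    conformalFactor (k + 2) m x = conformalProfile k m ‖x‖ := by
  simp [conformalFactor, conformalProfile]

theorem schwarzschildMetric_eq_profile (k : ℕ) (m : ℝ) :
    schwarzschildMetric (k + 2) m =
      fun x => conformalProfile k m ‖x‖ • (1 : Matrix (Fin (k + 2)) (Fin (k + 2)) ℝ) := by
  funext x
  rw [schwarzschildMetric, conformalFactor_eq_profile]

variable {k : ℕ} {m : ℝ}

theorem conformalProfile_pos (hm : 0 < m) {r : ℝ} (hr : 0 ≤ r) : 0 < conformalProfile k m r := by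
  unfold conformalProfile
  positivity

/-- This is the equation `F' = 2 r β F` that the radial curvature formulas take as hypothesis; it
identifies `logSlope` as the relevant `β`. -/
theorem hasDerivAt_conformalProfile (hk : 0 < k) (hm : 0 < m) {r : ℝ} (hr : 0 < r) :
    HasDerivAt (conformalProfile k m)
      (2 * conformalProfile k m r * (r * logSlope k m r)) r := by
  obtain ⟨l, rfl⟩ : ∃ l, k = l + 1 := ⟨k - 1, by omega⟩
  have hψ : 0 < 1 + m / (2 * r ^ (l + 1)) := by positivity
  have h1 : HasDerivAt (fun r : ℝ => 1 + m / (2 * r ^ (l + 1)))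
      ((0 * (2 * r ^ (l + 1)) - m * (2 * (((l + 1 : ℕ) : ℝ) * r ^ l))) /
        (2 * r ^ (l + 1)) ^ 2) r := by
    have h := ((hasDerivAt_const r m).div ((hasDerivAt_pow (l + 1) r).const_mul 2)
      (by positivity)).const_add 1
    simpa using h
  have h2 := h1.rpow_const (p := 4 / ((l + 1 : ℕ) : ℝ)) (Or.inl hψ.ne')
  refine h2.congr_deriv ?_
  rw [Real.rpow_sub_one hψ.ne']
  change _ = 2 * (1 + m / (2 * r ^ (l + 1))) ^ (4 / ((l + 1 : ℕ) : ℝ)) * _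
  set Z := (1 + m / (2 * r ^ (l + 1))) ^ (4 / ((l + 1 : ℕ) : ℝ))
  have hl : ((l + 1 : ℕ) : ℝ) ≠ 0 := by positivity
  have hs : r ^ (l + 1) * 2 + m ≠ 0 := by positivity
  have hs' : r * r ^ l * 2 + m ≠ 0 := by positivity
  simp only [logSlope]
  field_simp
  ring

theorem hasDerivAt_logSlope (hm : 0 < m) {r : ℝ} (hr : 0 < r) :
    HasDerivAt (logSlope k m)
      (m * ((k + 2) * r ^ k + m) / (r ^ 3 * (r ^ k + m / 2) ^ 2)) r := by
  have hpow : HasDerivAt (fun r : ℝ => r ^ k) (k * r ^ k / r) r := by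
    refine (hasDerivAt_pow k r).congr_deriv ?_
    rcases k with _ | l
    · simp
    · simp only [Nat.add_sub_cancel]
      field_simp
      ring
  have h := (hasDerivAt_const r (-m)).div ((hasDerivAt_pow 2 r).mul (hpow.add_const (m / 2)))
    (by simp only [Pi.mul_apply]; positivity)
  refine h.congr_deriv ?_
  simp only [Pi.mul_apply]
  have : r ^ k + m / 2 ≠ 0 := by positivity
  have : r ^ k * 2 + m ≠ 0 := by positivity
  field_simp
  push_cast
  ring

/-- The Ricci curvature of the Schwarzschild metric in directions tangent to the spheres. -/
theorem ricci_schwarzschild (hk : 0 < k) (hm : 0 < m) {x v : E (k + 2)} (hx : x ≠ 0)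
    (hv : inner ℝ x v = 0) :
    ricci (schwarzschildMetric (k + 2) m) x v v =
      k * m * ‖x‖ ^ k / (‖x‖ ^ 2 * (‖x‖ ^ k + m / 2) ^ 2) * ‖v‖ ^ 2 := by
  have hr : 0 < ‖x‖ := norm_pos_iff.2 hx
  rw [schwarzschildMetric_eq_profile, ricci_radial (β := logSlope k m)
    (fun r hr => (conformalProfile_pos hm hr.le).ne')
    (fun r hr => hasDerivAt_conformalProfile hk hm hr) hx (hasDerivAt_logSlope hm hr) hv]
  congr 1
  simp only [logSlope]
  set r := ‖x‖
  have : r ^ k + m / 2 ≠ 0 := by positivity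
  have : r ^ k * 2 + m ≠ 0 := by positivity
  field_simp
  push_cast
  ring

theorem covDeriv_schwarzschild (hk : 0 < k) (hm : 0 < m) {x : E (k + 2)} (hx : x ≠ 0)
    (Y : E (k + 2) → E (k + 2)) (v : E (k + 2)) :
    covDeriv (schwarzschildMetric (k + 2) m) Y x v =
      fderiv ℝ Y x v + (logSlope k m ‖x‖ * inner ℝ x v) • Y x +
        (logSlope k m ‖x‖ * inner ℝ x (Y x)) • v - (logSlope k m ‖x‖ * inner ℝ v (Y x)) • x := by
  rw [schwarzschildMetric_eq_profile]
  exact covDeriv_radial (fun r hr => (conformalProfile_pos hm hr.le).ne')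
    (fun r hr => hasDerivAt_conformalProfile hk hm hr) hx Y v

theorem differentiableAt_conformalFactor (hk : 0 < k) (hm : 0 < m) {x : E (k + 2)} (hx : x ≠ 0) :
    DifferentiableAt ℝ (conformalFactor (k + 2) m) x := by
  have : conformalFactor (k + 2) m = fun x => conformalProfile k m ‖x‖ :=
    funext fun x => conformalFactor_eq_profile k m x
  rw [this]
  exact (hasFDerivAt_comp_norm hx
    (hasDerivAt_conformalProfile hk hm (norm_pos_iff.2 hx))).differentiableAt

/-! ### The hyperplane -/

/-- The chart of the hyperplane as a linear map. -/
def chartLinear (d : ℕ) (ρ : E (d + 1) ≃ₗᵢ[ℝ] E (d + 1)) : E d →ₗ[ℝ] E (d + 1) where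
  toFun := chart d ρ
  map_add' y z := by
    rw [chart, chart, chart, ← map_add]
    congr 1
    ext i
    refine Fin.lastCases ?_ (fun i => ?_) i <;> simp
  map_smul' c y := by
    rw [chart, chart, RingHom.id_apply, ← map_smul]
    congr 1
    ext i
    refine Fin.lastCases ?_ (fun i => ?_) i <;> simp

theorem coordTangent_chart (d : ℕ) (ρ : E (d + 1) ≃ₗᵢ[ℝ] E (d + 1)) (i : Fin d) (y : E d) :
    coordTangent (chart d ρ) i y = chart d ρ (basisVec i) :=
  congrArg (fun L : E d →L[ℝ] E (d + 1) => L (basisVec i))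
    ((chartLinear d ρ).toContinuousLinearMap.hasFDerivAt (x := y)).fderiv

theorem inner_chart (d : ℕ) (ρ : E (d + 1) ≃ₗᵢ[ℝ] E (d + 1)) (y z : E d) :
    inner ℝ (chart d ρ y) (chart d ρ z) = inner ℝ y z := by
  rw [chart, chart, LinearIsometryEquiv.inner_map_map]
  simp [PiLp.inner_apply, Fin.sum_univ_castSucc]

theorem inner_chart_normal (d : ℕ) (ρ : E (d + 1) ≃ₗᵢ[ℝ] E (d + 1)) (y : E d) :
    inner ℝ (chart d ρ y) (ρ (basisVec (Fin.last d))) = 0 := by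
  rw [chart, LinearIsometryEquiv.inner_map_map, basisVec, EuclideanSpace.inner_single_right]
  simp

theorem norm_normal (d : ℕ) (ρ : E (d + 1) ≃ₗᵢ[ℝ] E (d + 1)) :
    ‖ρ (basisVec (Fin.last d))‖ = 1 := by
  simp [basisVec]

theorem chart_ne_zero {d : ℕ} (ρ : E (d + 1) ≃ₗᵢ[ℝ] E (d + 1)) {y : E d} (hy : y ≠ 0) :
    chart d ρ y ≠ 0 := by
  rw [← norm_ne_zero_iff, norm_chart]
  exact norm_ne_zero_iff.2 hy

variable {ρ : E (k + 1 + 1) ≃ₗᵢ[ℝ] E (k + 1 + 1)}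

theorem sigmaMetric_eq (y : E (k + 1)) :
    sigmaMetric (k + 1) m ρ y = conformalProfile k m ‖y‖ • 1 := by
  ext i j
  rw [sigmaMetric, inducedMetric, Matrix.of_apply, metricForm_schwarzschild,
    coordTangent_chart, coordTangent_chart, inner_chart, conformalFactor_eq_profile, norm_chart,
    Matrix.smul_apply, smul_eq_mul, Matrix.one_apply, basisVec, basisVec,
    EuclideanSpace.inner_single_right]
  simp [eq_comm]

/-- The hyperplane through the origin is totally geodesic. -/
theorem normSqSecondFundamentalForm_eq_zero (hk : 0 < k) (hm : 0 < m) {y : E (k + 1)}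
    (hy : y ≠ 0) :
    normSqSecondFundamentalForm (schwarzschildMetric (k + 1 + 1) m) (chart (k + 1) ρ)
      (normalField (k + 1) m ρ) y = 0 := by
  have hx := chart_ne_zero ρ hy
  have hA : ∀ v w : E (k + 1), secondFundamentalForm (schwarzschildMetric (k + 1 + 1) m)
      (normalField (k + 1) m ρ) (chart (k + 1) ρ y) (chart (k + 1) ρ v) (chart (k + 1) ρ w)
        = 0 := by
    intro v w
    have hc : DifferentiableAt ℝ (fun x => (√(conformalFactor (k + 1 + 1) m x))⁻¹)
        (chart (k + 1) ρ y) := by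
      have hpos := conformalFactor_pos (k + 1 + 1) m hm (chart (k + 1) ρ y)
      exact ((differentiableAt_conformalFactor hk hm hx).sqrt hpos.ne').inv
        (Real.sqrt_pos.2 hpos).ne'
    have hfd : fderiv ℝ (normalField (k + 1) m ρ) (chart (k + 1) ρ y) (chart (k + 1) ρ v) =
        (fderiv ℝ (fun x => (√(conformalFactor (k + 1 + 1) m x))⁻¹) (chart (k + 1) ρ y)
          (chart (k + 1) ρ v)) • ρ (basisVec (Fin.last (k + 1))) :=
      congrArg (fun L : E (k + 1 + 1) →L[ℝ] E (k + 1 + 1) => L (chart (k + 1) ρ v))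
        (hc.hasFDerivAt.smul_const (ρ (basisVec (Fin.last (k + 1))))).fderiv
    -- Every surviving term of `∇_v ξ` is a multiple of `ρ(e_n)`, since both `x` and `v` are
    -- orthogonal to `ξ`. Pairing with a tangent vector gives zero.
    rw [secondFundamentalForm, metricForm_schwarzschild, covDeriv_schwarzschild hk hm hx, hfd]
    simp only [normalField, inner_add_left, inner_sub_left, inner_smul_left, inner_smul_right,
      inner_chart_normal, real_inner_comm (chart (k + 1) ρ w) (ρ (basisVec (Fin.last (k + 1))))]
    simp
  simp [normSqSecondFundamentalForm, coordTangent_chart, hA]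

theorem horizonRadius_pos (n : ℕ) (hm : 0 < m) : 0 < horizonRadius n m := by
  unfold horizonRadius
  positivity

theorem horizonRadius_pow (hk : 0 < k) (hm : 0 < m) : horizonRadius (k + 2) m ^ k = m / 2 := by
  have hk' : (k : ℝ) ≠ 0 := by positivity
  rw [horizonRadius, ← Real.rpow_natCast, ← Real.rpow_mul (by positivity)]
  push_cast
  rw [add_sub_cancel_right, one_div_mul_cancel hk', Real.rpow_one]

/-- At the horizon `r = R₀` one has `1 + r² β = 0`. -/
theorem one_add_logSlope_horizon (hk : 0 < k) (hm : 0 < m) :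
    1 + horizonRadius (k + 2) m ^ 2 * logSlope k m (horizonRadius (k + 2) m) = 0 := by
  have h0 := horizonRadius_pos (k + 2) hm
  rw [logSlope, horizonRadius_pow hk hm]
  field_simp
  ring

/-- The horizon is totally geodesic. -/
theorem secondFundamentalForm_horizon (hk : 0 < k) (hm : 0 < m) {x v : E (k + 2)}
    (hx : ‖x‖ = horizonRadius (k + 2) m) (hv : inner ℝ x v = 0) :
    secondFundamentalForm (schwarzschildMetric (k + 2) m) (horizonNormal (k + 2) m) x v v = 0 := by
  have hr : 0 < ‖x‖ := hx ▸ horizonRadius_pos (k + 2) hm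
  have hx0 : x ≠ 0 := norm_pos_iff.1 hr
  have hpos := conformalFactor_pos (k + 2) m hm x
  set c : E (k + 2) → ℝ := fun x => (√(conformalFactor (k + 2) m x) * ‖x‖)⁻¹ with hcdef
  have hc : DifferentiableAt ℝ c x :=
    (((differentiableAt_conformalFactor hk hm hx0).sqrt hpos.ne').mul
      (differentiableAt_id.norm ℝ hx0)).inv (mul_pos (Real.sqrt_pos.2 hpos) hr).ne'
  have hfd : fderiv ℝ (horizonNormal (k + 2) m) x v = c x • v + (fderiv ℝ c x v) • x := by
    have := (hc.hasFDerivAt.smul (hasFDerivAt_id x)).fderiv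
    change fderiv ℝ (fun x => c x • x) x v = _
    exact congrArg (fun L : E (k + 2) →L[ℝ] E (k + 2) => L v) this
  have hη : horizonNormal (k + 2) m x = c x • x := rfl
  rw [secondFundamentalForm, metricForm_schwarzschild, covDeriv_schwarzschild hk hm hx0, hfd, hη]
  have hone := one_add_logSlope_horizon hk hm
  rw [← hx] at hone
  simp only [inner_add_left, inner_sub_left, inner_smul_left, inner_smul_right, hv,
    real_inner_self_eq_norm_sq, conj_trivial]
  -- With the radial terms removed by `hv`, the form equals `-F c (1 + r² β) |v|²`, and the middle
  -- factor vanishes at the horizon.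
  linear_combination (-conformalFactor (k + 2) m x * c x * ‖v‖ ^ 2) * hone

/-! ### The Jacobi operator in Euclidean divergence form -/

/-- The weight `√(det h) h^{ii}` of the Dirichlet integral on the hyperplane, as a function of
`r = |y|`. -/
def dirichletWeight (k : ℕ) (m r : ℝ) : ℝ :=
  √(conformalProfile k m r ^ (k + 1)) / conformalProfile k m r

/-- The potential `F Ric(ξ, ξ)`, where `F` is the conformal factor. -/
def potential (k : ℕ) (m r : ℝ) : ℝ := k * m * r ^ k / (r ^ 2 * (r ^ k + m / 2) ^ 2)

/-- The coefficient `κ` in `∇ w / w = -κ y` for the positive supersolution `w = 1 / (r √F)` of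
the Jacobi operator. -/
def barrierSlope (k : ℕ) (m r : ℝ) : ℝ := (1 + r ^ 2 * logSlope k m r) / r ^ 2

theorem volDensity_sigmaMetric (y : E (k + 1)) :
    volDensity (sigmaMetric (k + 1) m ρ) y = √(conformalProfile k m ‖y‖ ^ (k + 1)) := by
  rw [volDensity, sigmaMetric_eq, Matrix.det_smul]
  simp

theorem sigmaMetric_inv (hm : 0 < m) (y : E (k + 1)) :
    (sigmaMetric (k + 1) m ρ y)⁻¹ = (conformalProfile k m ‖y‖)⁻¹ • 1 := by
  rw [sigmaMetric_eq, smul_one_inv (conformalProfile_pos hm (norm_nonneg y)).ne']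

theorem dirichletWeight_pos (hm : 0 < m) {r : ℝ} (hr : 0 ≤ r) : 0 < dirichletWeight k m r := by
  have := conformalProfile_pos (k := k) hm hr
  exact div_pos (Real.sqrt_pos.2 (by positivity)) this

/-- Since `P = F^((k-1)/2)`, its logarithmic derivative is `(k - 1) / 2` times that of `F`. -/
theorem hasDerivAt_dirichletWeight (hk : 0 < k) (hm : 0 < m) {r : ℝ} (hr : 0 < r) :
    HasDerivAt (dirichletWeight k m)
      ((k - 1) * (r * logSlope k m r) * dirichletWeight k m r) r := by
  have hF := conformalProfile_pos (k := k) hm hr.le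
  have h1 := hasDerivAt_conformalProfile hk hm hr
  have hS : 0 < √(conformalProfile k m r ^ (k + 1)) := Real.sqrt_pos.2 (by positivity)
  have h2 := ((h1.fun_pow (k + 1)).sqrt (by positivity)).fun_div h1 hF.ne'
  refine h2.congr_deriv ?_
  have hSS : √(conformalProfile k m r ^ (k + 1)) ^ 2 = conformalProfile k m r ^ (k + 1) :=
    Real.sq_sqrt (by positivity)
  rw [dirichletWeight]
  set S := √(conformalProfile k m r ^ (k + 1))
  set F := conformalProfile k m r
  rw [Nat.add_sub_cancel]
  field_simp
  rw [hSS]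
  push_cast
  ring

/-- The Riccati equation of the barrier. Its term with the factor `k - 2 = n - 4` is nonnegative
exactly when `n ≥ 4`. -/
theorem hasDerivAt_weight_mul_barrierSlope (hk : 0 < k) (hm : 0 < m) {r : ℝ} (hr : 0 < r) :
    HasDerivAt (fun r => dirichletWeight k m r * barrierSlope k m r)
      (dirichletWeight k m r / r * (potential k m r + r ^ 2 * barrierSlope k m r ^ 2 +
        (k - 2) * (r * barrierSlope k m r) ^ 2 - (k + 1) * barrierSlope k m r)) r := by
  have hβ := hasDerivAt_logSlope (k := k) hm hr
  have hκ := (((hasDerivAt_pow 2 r).fun_mul hβ).const_add 1).fun_div (hasDerivAt_pow 2 r)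
    (by positivity)
  refine ((hasDerivAt_dirichletWeight hk hm hr).fun_mul hκ).congr_deriv ?_
  set P := dirichletWeight k m r
  have : r ^ k + m / 2 ≠ 0 := by positivity
  have : r ^ k * 2 + m ≠ 0 := by positivity
  simp only [barrierSlope, potential, logSlope]
  field_simp
  push_cast
  ring

/-- The density cancels the prefactor of the Laplacian, and conformal flatness reduces `√(det h)
h^{ij}` to the scalar `P δ^{ij}`. The fluxes agree pointwise, so no regularity of `w` is needed. -/
theorem laplaceBeltrami_sigmaMetric_mul (hm : 0 < m) (S : Set (E (k + 1))) (w : E (k + 1) → ℝ)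
    (y : E (k + 1)) :
    laplaceBeltrami (sigmaMetric (k + 1) m ρ) S w y * volDensity (sigmaMetric (k + 1) m ρ) y =
      ∑ i, pderivOn S i (fun z => dirichletWeight k m ‖z‖ * pderivOn S i w z) y := by
  have hF := conformalProfile_pos (k := k) hm (norm_nonneg y)
  have hfun : ∀ i, (fun z => volDensity (sigmaMetric (k + 1) m ρ) z *
      ∑ j, (sigmaMetric (k + 1) m ρ z)⁻¹ i j * pderivOn S j w z) =
      fun z => dirichletWeight k m ‖z‖ * pderivOn S i w z := by
    intro i
    funext z
    rw [volDensity_sigmaMetric, sigmaMetric_inv hm]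
    simp [Matrix.one_apply, dirichletWeight]
    ring
  have hv : volDensity (sigmaMetric (k + 1) m ρ) y ≠ 0 := by
    rw [volDensity_sigmaMetric]
    exact (Real.sqrt_pos.2 (by positivity)).ne'
  rw [laplaceBeltrami]
  simp only [hfun]
  field_simp

/-- The hyperplane is totally geodesic, and `ξ` is orthogonal to `x` with Euclidean square norm `1 /
F`. Hence only `Ric(ξ, ξ) = V / F` remains of the zeroth-order term, and the density turns it into
`V P`. -/
theorem jacobiOperator_mul_volDensity (hk : 0 < k) (hm : 0 < m) (R : ℝ) (w : E (k + 1) → ℝ)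
    {y : E (k + 1)} (hy : y ≠ 0) :
    jacobiOperator (k + 1) m ρ R w y * volDensity (sigmaMetric (k + 1) m ρ) y =
      ∑ i, pderivOn (annulus (k + 1) m R) i
        (fun z => dirichletWeight k m ‖z‖ * pderivOn (annulus (k + 1) m R) i w z) y +
      potential k m ‖y‖ * dirichletWeight k m ‖y‖ * w y := by
  have hF := conformalProfile_pos (k := k) hm (norm_nonneg y)
  have horth : inner ℝ (chart (k + 1) ρ y) (normalField (k + 1) m ρ (chart (k + 1) ρ y)) = 0 := by
    rw [normalField, inner_smul_right, inner_chart_normal, mul_zero]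
  have hnorm : ‖normalField (k + 1) m ρ (chart (k + 1) ρ y)‖ ^ 2 =
      (conformalProfile k m ‖y‖)⁻¹ := by
    rw [normalField, norm_smul, norm_normal, conformalFactor_eq_profile, norm_chart, mul_one,
      Real.norm_eq_abs, sq_abs, inv_pow, Real.sq_sqrt hF.le]
  rw [jacobiOperator, add_mul, laplaceBeltrami_sigmaMetric_mul hm,
    normSqSecondFundamentalForm_eq_zero hk hm hy, add_zero,
    ricci_schwarzschild hk hm (chart_ne_zero ρ hy) horth, hnorm, norm_chart,
    volDensity_sigmaMetric]
  simp only [potential, dirichletWeight]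
  ring

theorem conormalLength_eq (hm : 0 < m) {y : E (k + 1)} (hy : y ≠ 0) :
    conormalLength (k + 1) m ρ y = √(conformalProfile k m ‖y‖)⁻¹ := by
  have hr : ‖y‖ ≠ 0 := norm_ne_zero_iff.2 hy
  have hs : ∑ i, y i * y i = ‖y‖ ^ 2 := by
    rw [EuclideanSpace.real_norm_sq_eq]
    exact Finset.sum_congr rfl fun i _ => by ring
  rw [conormalLength, sigmaMetric_inv hm]
  congr 1
  have : ∀ i, ∑ j, ((conformalProfile k m ‖y‖)⁻¹ • (1 : Matrix (Fin (k + 1)) (Fin (k + 1)) ℝ)) i j *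
      conormalCovector (k + 1) y i * conormalCovector (k + 1) y j =
      (conformalProfile k m ‖y‖)⁻¹ / ‖y‖ ^ 2 * (y i * y i) := by
    intro i
    simp [Matrix.one_apply, conormalCovector]
    ring
  rw [Finset.sum_congr rfl fun i _ => this i, ← Finset.mul_sum, hs]
  field_simp

/-- The conormal length in `ds` cancels the normalisation of `ν`, leaving the Euclidean flux of `P
∇w` towards the origin, whence the sign. -/
theorem conormalDeriv_mul (hm : 0 < m) (R : ℝ) (w : E (k + 1) → ℝ) {y : E (k + 1)} (hy : y ≠ 0) :
    conormalDeriv (k + 1) m ρ R w y *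
        (volDensity (sigmaMetric (k + 1) m ρ) y * conormalLength (k + 1) m ρ y) =
      -∑ i, dirichletWeight k m ‖y‖ * pderivOn (annulus (k + 1) m R) i w y * (‖y‖⁻¹ * y i) := by
  have hF := conformalProfile_pos (k := k) hm (norm_nonneg y)
  have hl : conormalLength (k + 1) m ρ y ≠ 0 := by
    rw [conormalLength_eq hm hy]
    exact (Real.sqrt_pos.2 (by positivity)).ne'
  have hsum : ∀ i, ∑ j, (sigmaMetric (k + 1) m ρ y)⁻¹ i j * conormalCovector (k + 1) y j *
      pderivOn (annulus (k + 1) m R) i w y =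
      -((conformalProfile k m ‖y‖)⁻¹ * (pderivOn (annulus (k + 1) m R) i w y * (‖y‖⁻¹ * y i))) := by
    intro i
    rw [sigmaMetric_inv hm]
    simp [Matrix.one_apply, conormalCovector]
    ring
  rw [conormalDeriv]
  simp only [hsum, Finset.sum_neg_distrib, ← Finset.mul_sum]
  simp only [mul_assoc, ← Finset.mul_sum]
  rw [dirichletWeight, volDensity_sigmaMetric]
  field_simp

theorem contDiffOn_comp_norm {d : ℕ} {a b : ℝ} (ha : 0 < a) {l : WithTop ℕ∞} {g : ℝ → ℝ}
    (hg : ∀ r, 0 < r → ContDiffAt ℝ l g r) :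
    ContDiffOn ℝ l (fun y : E d => g ‖y‖) (shell d a b) := by
  intro y hy
  have hr : 0 < ‖y‖ := ha.trans_le hy.1
  exact ((hg _ hr).comp y (contDiffAt_norm ℝ (norm_pos_iff.1 hr))).contDiffWithinAt

theorem contDiffAt_conformalProfile (hm : 0 < m) {l : WithTop ℕ∞} {r : ℝ} (hr : 0 < r) :
    ContDiffAt ℝ l (conformalProfile k m) r := by
  have h : ContDiffAt ℝ l (fun r : ℝ => 1 + m / (2 * r ^ k)) r :=
    contDiffAt_const.add (contDiffAt_const.div (contDiffAt_const.mul (contDiffAt_id.pow k))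
      (by positivity))
  exact h.rpow_const_of_ne (by positivity)

theorem contDiffAt_dirichletWeight (hm : 0 < m) {l : WithTop ℕ∞} {r : ℝ} (hr : 0 < r) :
    ContDiffAt ℝ l (dirichletWeight k m) r := by
  have hF := conformalProfile_pos (k := k) hm hr.le
  have h := contDiffAt_conformalProfile (k := k) (l := l) hm hr
  exact ((h.pow (k + 1)).sqrt (by positivity)).div h hF.ne'

theorem contDiffAt_barrierSlope (hm : 0 < m) {l : WithTop ℕ∞} {r : ℝ} (hr : 0 < r) :
    ContDiffAt ℝ l (barrierSlope k m) r := by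
  have h : ContDiffAt ℝ l (logSlope k m) r :=
    contDiffAt_const.div ((contDiffAt_id.pow 2).mul ((contDiffAt_id.pow k).add contDiffAt_const))
      (by positivity)
  exact (contDiffAt_const.add ((contDiffAt_id.pow 2).mul h)).div (contDiffAt_id.pow 2)
    (by positivity)

theorem contDiffAt_potential (hm : 0 < m) {l : WithTop ℕ∞} {r : ℝ} (hr : 0 < r) :
    ContDiffAt ℝ l (potential k m) r :=
  (contDiffAt_const.mul (contDiffAt_id.pow k)).div
    ((contDiffAt_id.pow 2).mul (((contDiffAt_id.pow k).add contDiffAt_const).pow 2))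
    (by positivity)

/-! ### Comparison with the supersolution -/

/-- The field `P (u ∇u - u² ∇w / w)` that compares `u` with the positive supersolution `w` of
the Jacobi operator. -/
def comparisonField (k : ℕ) (m : ℝ) (S : Set (E (k + 1))) (u : E (k + 1) → ℝ) (i : Fin (k + 1))
    (y : E (k + 1)) : ℝ :=
  u y * (dirichletWeight k m ‖y‖ * pderivOn S i u y) +
    u y ^ 2 * (dirichletWeight k m ‖y‖ * barrierSlope k m ‖y‖ * y i)

section Shell

variable {a b : ℝ} {u : E (k + 1) → ℝ}

theorem contDiffOn_weight_mul_pderivOn (hm : 0 < m) (ha : 0 < a) (hab : a < b)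
    (hu : ContDiffOn ℝ 2 u (shell (k + 1) a b)) (i : Fin (k + 1)) :
    ContDiffOn ℝ 1 (fun y => dirichletWeight k m ‖y‖ * pderivOn (shell (k + 1) a b) i u y)
      (shell (k + 1) a b) :=
  (contDiffOn_comp_norm ha fun _ hr => contDiffAt_dirichletWeight hm hr).mul
    (contDiffOn_pderivOn ha hab hu (by norm_num) i)

theorem contDiffOn_comparisonField (hm : 0 < m) (ha : 0 < a) (hab : a < b)
    (hu : ContDiffOn ℝ 2 u (shell (k + 1) a b)) (i : Fin (k + 1)) :
    ContDiffOn ℝ 1 (comparisonField k m (shell (k + 1) a b) u i) (shell (k + 1) a b) := by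
  have hu1 : ContDiffOn ℝ 1 u (shell (k + 1) a b) := hu.of_le (by norm_num)
  have hc : ContDiff ℝ 1 (fun y : E (k + 1) => y i) := by fun_prop
  exact (hu1.mul (contDiffOn_weight_mul_pderivOn hm ha hab hu i)).add
    ((hu1.pow 2).mul (((contDiffOn_comp_norm ha fun _ hr => contDiffAt_dirichletWeight hm hr).mul
      (contDiffOn_comp_norm ha fun _ hr => contDiffAt_barrierSlope hm hr)).mul hc.contDiffOn))

/-- The product rule, with the radial derivative of `P κ` replaced through the Riccati equation and
the square completed in each coordinate. The remaining bracket simplifies only after summation over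
`i`. -/
theorem pderivOn_comparisonField (hk : 0 < k) (hm : 0 < m) (ha : 0 < a) (hab : a < b)
    (hu : ContDiffOn ℝ 2 u (shell (k + 1) a b)) {y : E (k + 1)} (hy : y ∈ shell (k + 1) a b)
    (i : Fin (k + 1)) :
    pderivOn (shell (k + 1) a b) i (comparisonField k m (shell (k + 1) a b) u i) y =
      u y * pderivOn (shell (k + 1) a b) i
        (fun z => dirichletWeight k m ‖z‖ * pderivOn (shell (k + 1) a b) i u z) y +
      dirichletWeight k m ‖y‖ *
        ((pderivOn (shell (k + 1) a b) i u y + u y * barrierSlope k m ‖y‖ * y i) ^ 2 +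
        u y ^ 2 * (barrierSlope k m ‖y‖ - barrierSlope k m ‖y‖ ^ 2 * y i ^ 2 +
          y i ^ 2 / ‖y‖ ^ 2 * (potential k m ‖y‖ + ‖y‖ ^ 2 * barrierSlope k m ‖y‖ ^ 2 +
            (k - 2) * (‖y‖ * barrierSlope k m ‖y‖) ^ 2 - (k + 1) * barrierSlope k m ‖y‖))) := by
  have hr : 0 < ‖y‖ := ha.trans_le hy.1
  have hy0 : y ≠ 0 := norm_pos_iff.1 hr
  have hud := (hu.differentiableOn (by norm_num) y hy).hasFDerivWithinAt
  have hzd := ((contDiffOn_weight_mul_pderivOn hm ha hab hu i).differentiableOn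
    (by norm_num) y hy).hasFDerivWithinAt
  have hPκ := (hasFDerivAt_radial_coord (β := fun r => dirichletWeight k m r * barrierSlope k m r)
    hy0 (hasDerivAt_weight_mul_barrierSlope hk hm hr) i).hasFDerivWithinAt
      (s := shell (k + 1) a b)
  have hsq : HasFDerivWithinAt (fun z => u z ^ 2)
      ((2 * u y) • fderivWithin ℝ u (shell (k + 1) a b) y) (shell (k + 1) a b) y := by
    simpa only [sq, two_mul, add_smul] using hud.fun_mul hud
  have hX := (hud.fun_mul hzd).fun_add (hsq.fun_mul hPκ)
  have hproj : (EuclideanSpace.proj i : E (k + 1) →L[ℝ] ℝ) (basisVec i) = 1 := by simp [basisVec]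
  have hfd := congrArg (fun L : E (k + 1) →L[ℝ] ℝ => L (basisVec i))
    (hX.fderivWithin (uniqueDiffOn_shell (k + 1) ha hab y hy))
  refine Eq.trans hfd ?_
  simp only [add_apply, smul_apply, hproj, innerSL_basisVec, smul_eq_mul]
  simp only [pderivOn]
  field_simp
  ring

/-- Summing with `∑ y_i² = r²` cancels the terms `(k + 1) κ` and `r² κ²`. The difference of the two
sides is then `P |∇u + u κ y|² + (k - 2) P u² r² κ²`, and the sign of the last term is where `k ≥ 2`
is used. -/
theorem mul_jacobi_le_divergence (hk : 2 ≤ k) (hm : 0 < m) (ha : 0 < a) (hab : a < b)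
    (hu : ContDiffOn ℝ 2 u (shell (k + 1) a b)) {y : E (k + 1)}
    (hy : y ∈ shell (k + 1) a b) :
    u y * (∑ i, pderivOn (shell (k + 1) a b) i
        (fun z => dirichletWeight k m ‖z‖ * pderivOn (shell (k + 1) a b) i u z) y +
      potential k m ‖y‖ * dirichletWeight k m ‖y‖ * u y) ≤
    ∑ i, pderivOn (shell (k + 1) a b) i (comparisonField k m (shell (k + 1) a b) u i) y := by
  have hr : 0 < ‖y‖ := ha.trans_le hy.1
  have hP := dirichletWeight_pos (k := k) hm hr.le
  have hs : ∑ i, y i ^ 2 = ‖y‖ ^ 2 := (EuclideanSpace.real_norm_sq_eq y).symm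
  rw [Finset.sum_congr rfl fun i _ => pderivOn_comparisonField (by omega) hm ha hab hu hy i]
  simp only [Finset.sum_add_distrib, Finset.sum_sub_distrib, ← Finset.mul_sum, ← Finset.sum_mul,
    ← Finset.sum_div, hs, Finset.sum_const, Finset.card_univ, Fintype.card_fin, nsmul_eq_mul]
  have hsq : 0 ≤ ∑ i, (pderivOn (shell (k + 1) a b) i u y +
      u y * barrierSlope k m ‖y‖ * y i) ^ 2 := Finset.sum_nonneg fun i _ => sq_nonneg _
  have hk2 : (0 : ℝ) ≤ k - 2 := by
    have : (2 : ℝ) ≤ k := by exact_mod_cast hk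
    linarith
  rw [div_self (pow_ne_zero 2 hr.ne')]
  push_cast
  have h1 := mul_nonneg hP.le hsq
  have h2 : 0 ≤ dirichletWeight k m ‖y‖ *
      (u y ^ 2 * ((k - 2) * (‖y‖ * barrierSlope k m ‖y‖) ^ 2)) := by positivity
  nlinarith [h1, h2]

end Shell

/-- The index form is nonnegative on admissible functions. -/
theorem indexForm_nonneg (hk : 2 ≤ k) (hm : 0 < m) {R : ℝ} (hR : horizonRadius (k + 1 + 1) m < R)
    {u : SigmaR (k + 1) m ρ R → ℝ} (hu : Admissible (k + 1) m ρ R u) :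
    0 ≤ indexForm (k + 1) m ρ R u := by
  have hk0 : 0 < k := by omega
  set a := horizonRadius (k + 1 + 1) m with hadef
  have ha : 0 < a := horizonRadius_pos _ hm
  set w : E (k + 1) → ℝ := inChart u with hw
  have hA : annulus (k + 1) m R = shell (k + 1) a R := rfl
  have hw2 : ContDiffOn ℝ 2 w (shell (k + 1) a R) := contDiffOn_infty.1 hu.1 2
  have hnz : ∀ y ∈ shell (k + 1) a R, y ≠ 0 := fun y hy =>
    norm_pos_iff.1 (ha.trans_le hy.1)
  have hnorm : ∀ r : ℝ, 0 < r → ∀ θ : Metric.sphere (0 : E (k + 1)) 1,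
      ‖r • (θ : E (k + 1))‖ = r := by
    intro r hr θ
    simp [norm_smul, abs_of_pos hr]
  have houter : ∀ y : E (k + 1), ‖y‖ = R → w y = 0 := by
    intro y hy
    rw [hw, inChart]
    split_ifs with h
    · exact hu.2 _ (by rw [norm_chart, hy])
    · rfl
  -- This is the Neumann condition for the supersolution: it removes the `u²` part of `X` from the
  -- flux through the horizon.
  have hkappa : barrierSlope k m a = 0 := by
    rw [barrierSlope, hadef, one_add_logSlope_horizon hk0 hm, zero_div]
  set X := comparisonField k m (shell (k + 1) a R) w with hX
  have hXs : ∀ i, ContDiffOn ℝ 1 (X i) (shell (k + 1) a R) :=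
    contDiffOn_comparisonField hm ha hR hw2
  have hdiv := integral_divergence_shell (Nat.succ_pos k) ha hR hXs
  have hX0 : ∀ (θ : Metric.sphere (0 : E (k + 1)) 1) i, X i (R • (θ : E (k + 1))) = 0 := by
    intro θ i
    simp [hX, comparisonField, houter _ (hnorm R (ha.trans hR) θ)]
  -- The Dirichlet condition kills the outer flux, so only the horizon contributes to the integral
  -- of `div X`.
  simp only [hX0, zero_mul, Finset.sum_const_zero, integral_zero, mul_zero, zero_sub] at hdiv
  have hle : ∫ y in annulus (k + 1) m R,
      w y * jacobiOperator (k + 1) m ρ R w y * volDensity (sigmaMetric (k + 1) m ρ) y ≤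
      ∫ y in shell (k + 1) a R, ∑ i, pderivOn (shell (k + 1) a R) i (X i) y := by
    rw [hA, setIntegral_congr_fun (isClosed_shell (k + 1) a R).measurableSet fun y hy =>
      show _ = w y * (∑ i, pderivOn (shell (k + 1) a R) i
        (fun z => dirichletWeight k m ‖z‖ * pderivOn (shell (k + 1) a R) i w z) y +
        potential k m ‖y‖ * dirichletWeight k m ‖y‖ * w y) by
          rw [mul_assoc, jacobiOperator_mul_volDensity hk0 hm R w (hnz y hy), hA]]
    refine setIntegral_mono_on ?_ ?_ (isClosed_shell (k + 1) a R).measurableSet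
      fun y hy => mul_jacobi_le_divergence hk hm ha hR hw2 hy
    · refine ContinuousOn.integrableOn_compact (isCompact_shell _ _ _) ?_
      refine hw2.continuousOn.mul ((continuousOn_finsetSum _ fun i _ => ?_).add
        (((contDiffOn_comp_norm (l := 0) ha fun _ hr =>
            contDiffAt_potential hm hr).continuousOn.mul
          (contDiffOn_comp_norm (l := 0) ha fun _ hr =>
            contDiffAt_dirichletWeight hm hr).continuousOn).mul hw2.continuousOn))
      exact (contDiffOn_pderivOn (k := 0) ha hR (contDiffOn_weight_mul_pderivOn hm ha hR hw2 i)
        (by simp) i).continuousOn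
    · refine ContinuousOn.integrableOn_compact (isCompact_shell _ _ _) ?_
      exact continuousOn_finsetSum _ fun i _ =>
        (contDiffOn_pderivOn (k := 0) ha hR (hXs i) (by simp) i).continuousOn
  -- With `A_{∂M} = 0` and `κ(R₀) = 0`, both sides are the flux of `P u ∇u` through the horizon
  -- towards the origin. The boundary term thus equals the integral of `div X` exactly, and `hle`
  -- finishes the proof.
  have hbd : boundaryIntegral (k + 1) m ρ (fun y =>
      w y * (conormalDeriv (k + 1) m ρ R w y -
        secondFundamentalForm (schwarzschildMetric (k + 1 + 1) m) (horizonNormal (k + 1 + 1) m)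
          (chart (k + 1) ρ y) (normalField (k + 1) m ρ (chart (k + 1) ρ y))
          (normalField (k + 1) m ρ (chart (k + 1) ρ y)) * w y)) =
      ∫ y in shell (k + 1) a R, ∑ i, pderivOn (shell (k + 1) a R) i (X i) y := by
    rw [hdiv, boundaryIntegral, integral_mul_const, mul_comm, ← mul_neg, ← integral_neg]
    congr 1
    refine integral_congr_ae (.of_forall fun θ => ?_)
    have hn := hnorm a ha θ
    have hy0 : a • (θ : E (k + 1)) ≠ 0 := norm_pos_iff.1 (by rw [hn]; exact ha)
    have hsff := secondFundamentalForm_horizon hk0 hm (x := chart (k + 1) ρ (a • (θ : E (k + 1))))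
      (v := normalField (k + 1) m ρ (chart (k + 1) ρ (a • (θ : E (k + 1)))))
      (by rw [norm_chart, hn])
      (by rw [normalField, inner_smul_right, inner_chart_normal, mul_zero])
    simp only [← hadef]
    rw [hsff, zero_mul, sub_zero, mul_assoc, conormalDeriv_mul hm R w hy0, hA, mul_neg,
      Finset.mul_sum]
    congr 1
    refine Finset.sum_congr rfl fun i _ => ?_
    simp only [hX, comparisonField, hn, hkappa]
    have : (a • (θ : E (k + 1))) i = a * (θ : E (k + 1)) i := rfl
    rw [this]
    field_simp
    ring
  rw [indexForm, ← hw, hbd]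
  linarith

theorem morseIndexR_eq_zero (hk : 2 ≤ k) (hm : 0 < m) {R : ℝ}
    (hR : horizonRadius (k + 1 + 1) m < R) : morseIndexR (k + 1) m ρ R = 0 := by
  refine iSup₂_eq_bot.2 ?_
  rintro V ⟨hadm, hneg⟩
  have hV : V = ⊥ := by
    rw [Submodule.eq_bot_iff]
    intro u hu
    by_contra hne
    exact (hneg u hu hne).not_ge (indexForm_nonneg hk hm hR (hadm u hu))
  subst hV
  simp

end Schwarzschild

end

theorem mainTheorem1 (d : ℕ) (hd : 4 ≤ d + 1) (m : ℝ) (hm : 0 < m)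
    (ρ : Schwarzschild.E (d + 1) ≃ₗᵢ[ℝ] Schwarzschild.E (d + 1)) :
    Schwarzschild.morseIndex d m ρ = 0 := by
  obtain ⟨k, rfl⟩ : ∃ k, d = k + 1 := ⟨d - 1, by omega⟩
  -- Radii `R ≤ R₀`, where the annulus degenerates, are irrelevant to the limsup.
  have hev : (fun R : ℝ => Schwarzschild.morseIndexR (k + 1) m ρ R) =ᶠ[atTop] fun _ => 0 :=
    (eventually_gt_atTop _).mono fun R hR =>
      Schwarzschild.morseIndexR_eq_zero (by omega) hm hR
  rw [Schwarzschild.morseIndex, limsup_congr hev, limsup_const]
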